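/- Let $N\ge 1$ be an integer and $C\in\mathbb R$. Write $\delta(x)$ for the Dirac measure at $x$ and $\mathbb E(\mu)=\int x\,\mu(dx)$. For $l<r$ let $\mathcal D_{AC}[l,r]$ be the set of Borel probability measures on $\mathbb R$ of the form $\rho(x)\,dx$, where $\rho$ vanishes outside $[l,r]$ and is nonincreasing on $[l,r]$ (with $\rho(l)=+\infty$ allowed), and let $\mathcal D[l,r]$ be the set of measures $\alpha\delta(l)+(1-\alpha)\mu'$ with $0\le\alpha\le1$ and $\mu'\in\mathcal D_{AC}[l,r]$. Put $\mathcal D[l,l]=\{\delta(l)\}$. A pair $(\vec l,\vec r)$ of $N$-tuples of real numbers is a *$C$-compatible boundary* if $0\le r_k-l_k\le C-(l_1+\dots+l_N)$ for all $k=1,\dots,N$. Let $\mathcal V^N[C]$ be the set of $N$-tuples $\vec\mu=(\mu_1,\dots,\mu_N)$ of Borel probability measures on $\mathbb R$ such that $\mathbb E(\mu_1)+\dots+\mathbb E(\mu_N)=C$ and there is a $C$-compatible boundary $(\vec l,\vec r)$ with $\mu_k\in\mathcal D[l_k,r_k]$ for all $k$. A *subextreme point* of a (not necessarily convex) subset $X$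 of a real vector space is a point $x\in X$ that cannot be written as $x=\alpha x_1+(1-\alpha)x_2$ with distinct $x_1,x_2\in X$ and $\alpha\in(0,1)$. Regard $\mathcal V^N[C]$ as a subset of the vector space of $N$-tuples of finite signed Borel measures on $\mathbb R$. **Theorem.** An $N$-tuple $\vec\mu$ of Borel probability measures on $\mathbb R$ is a subextreme point of $\mathcal V^N[C]$ if and only if there are real numbers $l_1,\dots,l_N$ with $l_1+\dots+l_N=C$ and $\mu_k=\delta(l_k)$ for all $k=1,\dots,N$. -/

import Mathlib

open MeasureTheory Set
open scoped ENNReal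

/-- The points of a (not necessarily convex) subset `X` of a real vector space which cannot be
written as `α x₁ + (1 - α) x₂` with distinct `x₁, x₂ ∈ X` and `α ∈ (0, 1)`. -/
def subextremePoints {E : Type*} [AddCommGroup E] [Module ℝ E] (X : Set E) : Set E :=
  {x | x ∈ X ∧ ¬ ∃ x₁ ∈ X, ∃ x₂ ∈ X, ∃ α : ℝ,
    x₁ ≠ x₂ ∧ 0 < α ∧ α < 1 ∧ x = α • x₁ + (1 - α) • x₂}

/-- Mathlib's extreme points are defined for every set, and are the subextreme points. -/
theorem subextremePoints_eq_extremePoints {E : Type*} [AddCommGroup E] [Module ℝ E]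
    (X : Set E) : subextremePoints X = X.extremePoints ℝ := by
  ext x
  constructor
  · rintro ⟨hx, h⟩
    refine ⟨hx, fun x₁ h₁ x₂ h₂ hs => ?_⟩
    obtain ⟨a, b, ha, hb, hab, rfl⟩ := hs
    have hb' : b = 1 - a := by linarith
    subst hb'
    by_cases h12 : x₁ = x₂
    · subst h12
      rw [← add_smul]
      simp
    · exact absurd ⟨x₁, h₁, x₂, h₂, a, h12, ha, by linarith, rfl⟩ h
  · rintro ⟨hx, h⟩
    refine ⟨hx, ?_⟩
    rintro ⟨x₁, h₁, x₂, h₂, α, hne, h0, h1, rfl⟩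
    have e := h h₁ h₂ ⟨α, 1 - α, h0, by linarith, by ring, rfl⟩
    have e2 : (1 - α) • x₁ = (1 - α) • x₂ := by
      have e3 : x₁ - α • x₁ = (1 - α) • x₂ := by
        rw [sub_eq_iff_eq_add']
        exact e
      rw [← e3, sub_smul, one_smul]
    exact hne (smul_right_injective E (by linarith : (1 - α) ≠ 0) e2)

/-- `𝓓_AC[l, r]`: probability measures `ρ(x) dx` on `[l, r]` with a density `ρ` that is
nonincreasing on `[l, r]`; the value `ρ(l) = +∞` is allowed. -/
def DecreasingAC (l r : ℝ) : Set (ProbabilityMeasure ℝ) :=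
  {μ | ∃ ρ : ℝ → ℝ≥0∞, AntitoneOn ρ (Icc l r) ∧
    (μ : Measure ℝ) = (volume.restrict (Icc l r)).withDensity ρ}

/-- `𝓓[l, r]`: the measures `α δ(l) + (1 - α) μ'` with `α ∈ [0, 1]` and `μ' ∈ 𝓓_AC[l, r]` if
`l < r`, and `𝓓[l, l] = {δ(l)}`. -/
def Decreasing (l r : ℝ) : Set (ProbabilityMeasure ℝ) :=
  {μ | (l = r ∧ (μ : Measure ℝ) = Measure.dirac l) ∨
    (l < r ∧ ∃ α : ℝ, 0 ≤ α ∧ α ≤ 1 ∧ ∃ μ' ∈ DecreasingAC l r,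
      (μ : Measure ℝ) =
        ENNReal.ofReal α • Measure.dirac l + ENNReal.ofReal (1 - α) • (μ' : Measure ℝ))}

/-- `(l, r)` is a `C`-compatible boundary. -/
def CompatibleBoundary {N : ℕ} (C : ℝ) (l r : Fin N → ℝ) : Prop :=
  ∀ k, 0 ≤ r k - l k ∧ r k - l k ≤ C - ∑ i, l i

/-- The set `𝓥^N[C]` of tuples of probability measures. -/
def VSet (N : ℕ) (C : ℝ) : Set (Fin N → ProbabilityMeasure ℝ) :=
  {μ | ∑ k, ∫ x, x ∂(μ k : Measure ℝ) = C ∧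
    ∃ l r : Fin N → ℝ, CompatibleBoundary C l r ∧ ∀ k, μ k ∈ Decreasing (l k) (r k)}

/-- A tuple of probability measures as an element of the real vector space of tuples of finite
signed Borel measures. -/
noncomputable def toSignedTuple {N : ℕ} (μ : Fin N → ProbabilityMeasure ℝ) :
    Fin N → SignedMeasure ℝ :=
  fun k => (μ k : Measure ℝ).toSignedMeasure

/-- A measure consisting of an atom at `l` and a nonincreasing density on `(l, r]`. -/
def IsDec (l r : ℝ) (ν : Measure ℝ) : Prop :=
  ∃ (p : ℝ≥0∞) (g : ℝ → ℝ≥0∞), Antitone g ∧ (∀ x, r < x → g x = 0) ∧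
    ν = p • Measure.dirac l + (volume.restrict (Ioi l)).withDensity g

namespace IsDec

variable {l r : ℝ} {ν ν' : Measure ℝ}

theorem add (h : IsDec l r ν) (h' : IsDec l r ν') : IsDec l r (ν + ν') := by
  obtain ⟨p, g, hg, h0, rfl⟩ := h
  obtain ⟨p', g', hg', h0', rfl⟩ := h'
  refine ⟨p + p', g + g', hg.add hg', fun x hx => by simp [h0 x hx, h0' x hx], ?_⟩
  rw [withDensity_add_left hg.measurable, add_smul]
  abel

theorem smul (h : IsDec l r ν) (c : ℝ≥0∞) : IsDec l r (c • ν) := by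
  obtain ⟨p, g, hg, h0, rfl⟩ := h
  refine ⟨c * p, c • g, fun x y hxy => ?_, fun x hx => by simp [h0 x hx], ?_⟩
  · simpa using mul_le_mul_right (hg hxy) c
  rw [withDensity_smul _ hg.measurable, smul_add, mul_smul]

theorem mono_right {r' : ℝ} (h : IsDec l r ν) (hr : r ≤ r') : IsDec l r' ν := by
  obtain ⟨p, g, hg, h0, rfl⟩ := h
  exact ⟨p, g, hg, fun x hx => h0 x (hr.trans_lt hx), rfl⟩

theorem dirac : IsDec l r (Measure.dirac l) :=
  ⟨1, 0, fun _ _ _ => le_rfl, fun _ _ => rfl, by simp⟩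

theorem restrict_Ioc : IsDec l r (volume.restrict (Ioc l r)) := by
  refine ⟨0, (Iic r).indicator 1, fun x y hxy => ?_, fun x hx => by simp [hx], ?_⟩
  · by_cases hy : y ≤ r
    · simp [hy, hxy.trans hy]
    · simp [hy]
  · rw [withDensity_indicator_one measurableSet_Iic, Measure.restrict_restrict measurableSet_Iic]
    simp [Iic_inter_Ioi]

theorem ae_mem_Icc (h : IsDec l r ν) (hlr : l ≤ r) : ∀ᵐ x ∂ν, x ∈ Icc l r := by
  obtain ⟨p, g, hg, h0, rfl⟩ := h
  rw [ae_add_measure_iff]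
  constructor
  · refine Measure.ae_smul_measure ?_ p
    exact (ae_dirac_iff (p := fun x => x ∈ Icc l r) measurableSet_Icc).2 ⟨le_rfl, hlr⟩
  · rw [ae_withDensity_iff hg.measurable]
    filter_upwards [ae_restrict_mem measurableSet_Ioi] with x hx hgx
    refine ⟨(mem_Ioi.1 hx).le, not_lt.1 fun hlt => hgx (h0 x hlt)⟩

theorem integrable_id [IsFiniteMeasure ν] (h : IsDec l r ν) (hlr : l ≤ r) :
    Integrable (fun x : ℝ => x) ν := by
  refine Integrable.of_bound measurable_id.aestronglyMeasurable (|l| + |r|) ?_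
  filter_upwards [h.ae_mem_Icc hlr] with x hx
  rw [Real.norm_eq_abs, abs_le]
  constructor
  · have := neg_abs_le l
    have := abs_nonneg r
    linarith [hx.1]
  · have := le_abs_self r
    have := abs_nonneg l
    linarith [hx.2]

end IsDec

theorem decreasingAC_nonempty {l r : ℝ} (h : l < r) : (DecreasingAC l r).Nonempty := by
  have hv : volume (Icc l r) ≠ 0 := by simp [h]
  have hv' : volume (Icc l r) ≠ ⊤ := by simp
  refine ⟨⟨(volume (Icc l r))⁻¹ • volume.restrict (Icc l r), ⟨?_⟩⟩,
    fun _ => (volume (Icc l r))⁻¹, fun _ _ _ _ _ => le_rfl, ?_⟩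
  · simp only [Measure.smul_apply, Measure.restrict_apply_univ, smul_eq_mul]
    exact ENNReal.inv_mul_cancel hv hv'
  · simp [withDensity_const]

theorem mem_decreasing_of_isDec {l r : ℝ} (hlr : l ≤ r) {μ : ProbabilityMeasure ℝ}
    (h : IsDec l r (μ : Measure ℝ)) : μ ∈ Decreasing l r := by
  obtain ⟨p, g, hg, h0, hμ⟩ := h
  set m := (volume.restrict (Ioi l)).withDensity g univ with hm
  have hsum : p + m = 1 := by
    have := congrArg (fun ν : Measure ℝ => ν univ) hμ
    simpa [hm] using this.symm
  rcases hlr.eq_or_lt with rfl | hlt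
  · left
    refine ⟨rfl, ?_⟩
    have hz : (volume.restrict (Ioi l)).withDensity g = 0 := by
      rw [withDensity_eq_zero_iff hg.measurable.aemeasurable]
      filter_upwards [ae_restrict_mem measurableSet_Ioi] with x hx
      exact h0 x hx
    have hp : p = 1 := by simpa [hm, hz] using hsum
    rw [hμ, hz, hp]
    simp
  · right
    refine ⟨hlt, ?_⟩
    have hp1 : p ≤ 1 := hsum ▸ le_self_add
    have hpt : p ≠ ⊤ := ne_top_of_le_ne_top ENNReal.one_ne_top hp1
    have hptr : p.toReal ≤ 1 := by
      simpa using ENNReal.toReal_mono ENNReal.one_ne_top hp1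
    have e1 : ENNReal.ofReal p.toReal = p := ENNReal.ofReal_toReal hpt
    have e2 : ENNReal.ofReal (1 - p.toReal) = m := by
      rw [ENNReal.ofReal_sub _ ENNReal.toReal_nonneg, e1, ENNReal.ofReal_one, ← hsum]
      exact ENNReal.add_sub_cancel_left hpt
    refine ⟨p.toReal, ENNReal.toReal_nonneg, hptr, ?_⟩
    rw [e1, e2]
    by_cases hm0 : m = 0
    · obtain ⟨μ', hμ'⟩ := decreasingAC_nonempty hlt
      refine ⟨μ', hμ', ?_⟩
      have hz : (volume.restrict (Ioi l)).withDensity g = 0 := Measure.measure_univ_eq_zero.1 hm0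
      rw [hμ, hz, hm0]
      simp
    · have hmt : m ≠ ⊤ := ne_top_of_le_ne_top ENNReal.one_ne_top (hsum ▸ le_add_self)
      have hr : (volume.restrict (Icc l r)).withDensity (m⁻¹ • g)
          = m⁻¹ • (volume.restrict (Ioi l)).withDensity g := by
        rw [withDensity_smul _ hg.measurable, ← Measure.restrict_congr_set Ioc_ae_eq_Icc]
        congr 1
        rw [← withDensity_indicator measurableSet_Ioc, ← withDensity_indicator measurableSet_Ioi]
        congr 1
        ext x
        by_cases hx : l < x <;> by_cases hx' : x ≤ r <;> simp [hx, hx']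
        exact (h0 x (not_le.1 hx')).symm
      refine ⟨⟨m⁻¹ • (volume.restrict (Ioi l)).withDensity g, ⟨?_⟩⟩, ⟨m⁻¹ • g, ?_, hr.symm⟩, ?_⟩
      · rw [Measure.smul_apply, ← hm, smul_eq_mul, ENNReal.inv_mul_cancel hm0 hmt]
      · intro x _ y _ hxy
        simpa using mul_le_mul_right (hg hxy) m⁻¹
      · change (μ : Measure ℝ) = p • Measure.dirac l +
          m • (m⁻¹ • (volume.restrict (Ioi l)).withDensity g)
        rw [smul_smul, ENNReal.mul_inv_cancel hm0 hmt, one_smul, hμ]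

theorem isDec_of_mem_decreasing {l r : ℝ} {μ : ProbabilityMeasure ℝ} (h : μ ∈ Decreasing l r) :
    l ≤ r ∧ IsDec l r (μ : Measure ℝ) := by
  rcases h with ⟨rfl, h⟩ | ⟨hlt, α, h0, h1, μ', ⟨ρ, hρ, hμ'⟩, h⟩
  · rw [h]
    exact ⟨le_rfl, IsDec.dirac⟩
  · refine ⟨hlt.le, ?_⟩
    rw [h]
    refine (IsDec.dirac.smul _).add (IsDec.smul ?_ _)
    refine ⟨0, fun x => if x ≤ l then ⊤ else if x ≤ r then ρ x else 0, ?_, ?_, ?_⟩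
    · intro x y hxy
      dsimp only
      by_cases hx : x ≤ l
      · simp [hx]
      by_cases hy : y ≤ r
      · have hx' := not_le.1 hx
        simp only [hx, hy, hxy.trans hy, not_le.2 (hx'.trans_le hxy), if_false, if_true]
        exact hρ ⟨hx'.le, hxy.trans hy⟩ ⟨hx'.le.trans hxy, hy⟩ hxy
      · have hx' := not_le.1 hx
        simp [hy, not_le.2 (hx'.trans_le hxy)]
    · intro x hx
      simp [not_le.2 hx, not_le.2 (hlt.trans hx)]
    · rw [hμ', zero_smul, zero_add, ← Measure.restrict_congr_set Ioc_ae_eq_Icc,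
        ← withDensity_indicator measurableSet_Ioc, ← withDensity_indicator measurableSet_Ioi]
      congr 1
      ext x
      by_cases hx : l < x <;> by_cases hx' : x ≤ r <;> simp [hx, hx', not_le.2]

theorem exists_convexComb {w₁ w₂ w₃ : ℝ} (h₁ : 0 ≤ w₁) (h₂ : 0 ≤ w₂) (h₃ : 0 ≤ w₃)
    (hs : w₁ + w₂ + w₃ = 1) (ν₁ ν₂ ν₃ : ProbabilityMeasure ℝ) :
    ∃ M : ProbabilityMeasure ℝ, (M : Measure ℝ) = ENNReal.ofReal w₁ • (ν₁ : Measure ℝ) +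
      ENNReal.ofReal w₂ • (ν₂ : Measure ℝ) + ENNReal.ofReal w₃ • (ν₃ : Measure ℝ) := by
  refine ⟨⟨_, ⟨?_⟩⟩, rfl⟩
  simp only [Measure.coe_add, Pi.add_apply, Measure.smul_apply, measure_univ, smul_eq_mul, mul_one]
  rw [← ENNReal.ofReal_add h₁ h₂, ← ENNReal.ofReal_add (add_nonneg h₁ h₂) h₃, hs,
    ENNReal.ofReal_one]

theorem convexComb_real {w₁ w₂ w₃ : ℝ} (h₁ : 0 ≤ w₁) (h₂ : 0 ≤ w₂) (h₃ : 0 ≤ w₃)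
    {M ν₁ ν₂ ν₃ : ProbabilityMeasure ℝ}
    (hM : (M : Measure ℝ) = ENNReal.ofReal w₁ • (ν₁ : Measure ℝ) +
      ENNReal.ofReal w₂ • (ν₂ : Measure ℝ) + ENNReal.ofReal w₃ • (ν₃ : Measure ℝ)) (S : Set ℝ) :
    (M : Measure ℝ).real S = w₁ * (ν₁ : Measure ℝ).real S + w₂ * (ν₂ : Measure ℝ).real S
      + w₃ * (ν₃ : Measure ℝ).real S := by
  have hf : ∀ (w : ℝ) (ν : ProbabilityMeasure ℝ), ENNReal.ofReal w * (ν : Measure ℝ) S ≠ ⊤ :=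
    fun w ν => ENNReal.mul_ne_top ENNReal.ofReal_ne_top (measure_ne_top _ _)
  simp only [Measure.real, hM, Measure.coe_add, Pi.add_apply, Measure.smul_apply, smul_eq_mul]
  rw [ENNReal.toReal_add (ENNReal.add_ne_top.2 ⟨hf _ _, hf _ _⟩) (hf _ _),
    ENNReal.toReal_add (hf _ _) (hf _ _)]
  simp [ENNReal.toReal_mul, ENNReal.toReal_ofReal, h₁, h₂, h₃]

theorem probabilityMeasure_ext_real {μ ν : ProbabilityMeasure ℝ}
    (h : ∀ S, MeasurableSet S → (μ : Measure ℝ).real S = (ν : Measure ℝ).real S) : μ = ν := by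
  apply Subtype.ext
  ext S hS
  have := h S hS
  rwa [measureReal_eq_measureReal_iff] at this

/-- `ν` is a mixture of `A` and `B` with weights `1 - ε` and `ε`. -/
def IsMix (ε : ℝ) (ν A B : ProbabilityMeasure ℝ) : Prop :=
  ∀ S, MeasurableSet S →
    (ν : Measure ℝ).real S = (1 - ε) * (A : Measure ℝ).real S + ε * (B : Measure ℝ).real S

theorem IsMix.measure_eq {ε : ℝ} {ν A B : ProbabilityMeasure ℝ} (h0 : 0 ≤ ε) (h1 : ε ≤ 1)
    (h : IsMix ε ν A B) : (ν : Measure ℝ) =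
      ENNReal.ofReal (1 - ε) • (A : Measure ℝ) + ENNReal.ofReal ε • (B : Measure ℝ) := by
  obtain ⟨M, hM⟩ := exists_convexComb (sub_nonneg.2 h1) h0 le_rfl (by ring) A B B
  have : ν = M := probabilityMeasure_ext_real fun S hS => by
    rw [convexComb_real (sub_nonneg.2 h1) h0 le_rfl hM, h S hS]
    ring
  rw [this, hM]
  simp

theorem IsMix.eq_of_eq {ε : ℝ} {ν A B : ProbabilityMeasure ℝ} (h : IsMix ε ν A B) (hAB : A = B) :
    ν = B := probabilityMeasure_ext_real fun S hS => by
  rw [h S hS, hAB]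
  ring

/-- In the coordinate `t ↦ o + d * t`, the measure `ν` is carried by `[u, v]`, decreasing, and has
mean `e / 2`. -/
structure HasShape (o d u v e : ℝ) (ν : ProbabilityMeasure ℝ) : Prop where
  isDec : IsDec (o + d * u) (o + d * v) (ν : Measure ℝ)
  le : u ≤ v
  mean : ∫ x, x ∂(ν : Measure ℝ) = o + d * e / 2

namespace HasShape

variable {o d u v e e' : ℝ} {ν : ProbabilityMeasure ℝ}

theorem integrable (hd : 0 < d) (h : HasShape o d u v e ν) :
    Integrable (fun x : ℝ => x) (ν : Measure ℝ) :=
  h.isDec.integrable_id (by nlinarith [h.le])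

theorem mono_right (hd : 0 < d) {v' : ℝ} (h : HasShape o d u v e ν) (hv : v ≤ v') :
    HasShape o d u v' e ν :=
  ⟨h.isDec.mono_right (by nlinarith), h.le.trans hv, h.mean⟩

theorem unique (hd : 0 < d) {u' v' : ℝ} (h : HasShape o d u v e ν)
    (h' : HasShape o d u' v' e' ν) : e = e' := by
  have := h.mean.symm.trans h'.mean
  have h2 : d * (e - e') = 0 := by linarith
  rcases mul_eq_zero.1 h2 with h3 | h3 <;> linarith

theorem convexComb (hd : 0 < d) {w₁ w₂ w₃ e₁ e₂ e₃ : ℝ} (h₁ : 0 ≤ w₁) (h₂ : 0 ≤ w₂) (h₃ : 0 ≤ w₃)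
    (hs : w₁ + w₂ + w₃ = 1) {M ν₁ ν₂ ν₃ : ProbabilityMeasure ℝ}
    (hM : (M : Measure ℝ) = ENNReal.ofReal w₁ • (ν₁ : Measure ℝ) +
      ENNReal.ofReal w₂ • (ν₂ : Measure ℝ) + ENNReal.ofReal w₃ • (ν₃ : Measure ℝ))
    (s₁ : HasShape o d u v e₁ ν₁) (s₂ : HasShape o d u v e₂ ν₂) (s₃ : HasShape o d u v e₃ ν₃) :
    HasShape o d u v (w₁ * e₁ + w₂ * e₂ + w₃ * e₃) M := by
  refine ⟨?_, s₁.le, ?_⟩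
  · rw [hM]
    exact ((s₁.isDec.smul _).add (s₂.isDec.smul _)).add (s₃.isDec.smul _)
  · have i₁ := (s₁.integrable hd).smul_measure (c := ENNReal.ofReal w₁) ENNReal.ofReal_ne_top
    have i₂ := (s₂.integrable hd).smul_measure (c := ENNReal.ofReal w₂) ENNReal.ofReal_ne_top
    have i₃ := (s₃.integrable hd).smul_measure (c := ENNReal.ofReal w₃) ENNReal.ofReal_ne_top
    rw [hM, integral_add_measure (i₁.add_measure i₂) i₃, integral_add_measure i₁ i₂]
    simp only [integral_smul_measure, s₁.mean, s₂.mean, s₃.mean, ENNReal.toReal_ofReal h₁,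
      ENNReal.toReal_ofReal h₂, ENNReal.toReal_ofReal h₃, smul_eq_mul]
    linear_combination o * hs

theorem mean_of_isMix (hd : 0 < d) {ε u₁ v₁ e₁ u₂ v₂ e₂ : ℝ} (h0 : 0 ≤ ε) (h1 : ε ≤ 1)
    {A B : ProbabilityMeasure ℝ} (h : IsMix ε ν A B) (s : HasShape o d u v e ν)
    (s₁ : HasShape o d u₁ v₁ e₁ A) (s₂ : HasShape o d u₂ v₂ e₂ B) :
    e = (1 - ε) * e₁ + ε * e₂ := by
  have i₁ := (s₁.integrable hd).smul_measure (c := ENNReal.ofReal (1 - ε)) ENNReal.ofReal_ne_top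
  have i₂ := (s₂.integrable hd).smul_measure (c := ENNReal.ofReal ε) ENNReal.ofReal_ne_top
  have := s.mean
  rw [h.measure_eq h0 h1, integral_add_measure i₁ i₂, integral_smul_measure, integral_smul_measure,
    s₁.mean, s₂.mean, ENNReal.toReal_ofReal h0, ENNReal.toReal_ofReal (sub_nonneg.2 h1),
    smul_eq_mul, smul_eq_mul] at this
  have h2 : d * (e - ((1 - ε) * e₁ + ε * e₂)) = 0 := by linarith
  rcases mul_eq_zero.1 h2 with h3 | h3 <;> linarith

end HasShape

/-- The uniform distribution on `[l, r]` (the Dirac measure at `l` unless `l < r`). -/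
noncomputable def unif (l r : ℝ) : ProbabilityMeasure ℝ :=
  ⟨if l < r then (volume (Ioc l r))⁻¹ • volume.restrict (Ioc l r) else Measure.dirac l, by
    split_ifs with h
    · constructor
      rw [Measure.smul_apply, Measure.restrict_apply_univ, smul_eq_mul]
      exact ENNReal.inv_mul_cancel (by simp [h]) (by simp)
    · infer_instance⟩

theorem unif_of_lt {l r : ℝ} (h : l < r) : (unif l r : Measure ℝ) =
    (volume (Ioc l r))⁻¹ • volume.restrict (Ioc l r) := if_pos h

theorem unif_self (l : ℝ) : (unif l l : Measure ℝ) = Measure.dirac l := if_neg (lt_irrefl l)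

theorem isDec_unif {l r : ℝ} (h : l ≤ r) : IsDec l r (unif l r : Measure ℝ) := by
  rcases h.eq_or_lt with rfl | h
  · rw [unif_self]
    exact IsDec.dirac
  · rw [unif_of_lt h]
    exact IsDec.restrict_Ioc.smul _

theorem mean_unif {l r : ℝ} (h : l ≤ r) : ∫ x, x ∂(unif l r : Measure ℝ) = (l + r) / 2 := by
  rcases h.eq_or_lt with rfl | h
  · rw [unif_self, integral_dirac]
    ring
  · rw [unif_of_lt h, integral_smul_measure, ← intervalIntegral.integral_of_le h.le, integral_id]
    have : r - l ≠ 0 := (sub_pos.2 h).ne'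
    simp only [Real.volume_Ioc, ENNReal.toReal_inv, ENNReal.toReal_ofReal (sub_pos.2 h).le,
      smul_eq_mul]
    field_simp
    ring

theorem sub_mul_unif_real {l r : ℝ} (h : l ≤ r) {S : Set ℝ} (hS : MeasurableSet S) :
    (r - l) * (unif l r : Measure ℝ).real S = volume.real (S ∩ Ioc l r) := by
  rcases h.eq_or_lt with rfl | h
  · simp
  · have : r - l ≠ 0 := (sub_pos.2 h).ne'
    rw [unif_of_lt h, measureReal_ennreal_smul_apply, measureReal_restrict_apply hS]
    simp only [Real.volume_Ioc, ENNReal.toReal_inv, ENNReal.toReal_ofReal (sub_pos.2 h).le]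
    field_simp

theorem unif_real_split {u s t : ℝ} (h₁ : u ≤ s) (h₂ : s ≤ t) {S : Set ℝ} (hS : MeasurableSet S) :
    (t - u) * (unif u t : Measure ℝ).real S =
      (s - u) * (unif u s : Measure ℝ).real S + (t - s) * (unif s t : Measure ℝ).real S := by
  rw [sub_mul_unif_real (h₁.trans h₂) hS, sub_mul_unif_real h₁ hS, sub_mul_unif_real h₂ hS,
    ← Ioc_union_Ioc_eq_Ioc h₁ h₂, inter_union_distrib_left]
  refine measureReal_union ?_ (hS.inter measurableSet_Ioc)
    (ne_top_of_le_ne_top (by simp) (measure_mono (inter_subset_right (t := Ioc u s))))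
    (ne_top_of_le_ne_top (by simp) (measure_mono (inter_subset_right (t := Ioc s t))))
  exact (Ioc_disjoint_Ioc_of_le le_rfl).mono inter_subset_right inter_subset_right

/-- The uniform distribution on `[u, v]` in the coordinate `t ↦ o + d * t`. -/
noncomputable def unifAt (o d u v : ℝ) : ProbabilityMeasure ℝ := unif (o + d * u) (o + d * v)

theorem hasShape_unifAt {o d u v : ℝ} (hd : 0 < d) (h : u ≤ v) :
    HasShape o d u v (u + v) (unifAt o d u v) := by
  have h' : o + d * u ≤ o + d * v := by nlinarith
  refine ⟨isDec_unif h', h, ?_⟩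
  rw [unifAt, mean_unif h']
  ring

theorem unifAt_real_split {o d s t : ℝ} (hd : 0 < d) (h₁ : 0 ≤ s) (h₂ : s ≤ t) {S : Set ℝ}
    (hS : MeasurableSet S) :
    t * (unifAt o d 0 t : Measure ℝ).real S =
      s * (unifAt o d 0 s : Measure ℝ).real S + (t - s) * (unifAt o d s t : Measure ℝ).real S := by
  have := unif_real_split (u := o + d * 0) (s := o + d * s) (t := o + d * t) (by nlinarith)
    (by nlinarith) hS
  apply mul_left_cancel₀ hd.ne'
  unfold unifAt
  linear_combination this

theorem isMix_unifAt_of_eq {o d t ε : ℝ} (hd : 0 < d) (ht : 0 ≤ t) (h0 : 0 ≤ ε) (h1 : ε ≤ 1) :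
    IsMix ε (unifAt o d 0 t) (unifAt o d 0 ((1 - ε) * t)) (unifAt o d ((1 - ε) * t) t) := by
  intro S hS
  rcases ht.eq_or_lt with rfl | ht
  · simp only [mul_zero]
    ring
  · have := unifAt_real_split (o := o) hd (mul_nonneg (sub_nonneg.2 h1) ht.le)
      (by nlinarith : (1 - ε) * t ≤ t) hS
    apply mul_left_cancel₀ ht.ne'
    linear_combination this

theorem exists_isMix_unifAt {o d s t ε : ℝ} (hd : 0 < d) (ht : 0 ≤ t) (h0 : 0 ≤ ε) (h1 : ε < 1)
    (hs : 0 ≤ s) (hst : s ≤ (1 - ε) * t) :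
    ∃ A, IsMix ε (unifAt o d 0 t) A (unifAt o d s t) ∧ ∃ e, HasShape o d 0 t e A := by
  have h1' : 0 < 1 - ε := sub_pos.2 h1
  rcases (by nlinarith : s ≤ t).eq_or_lt with rfl | hlt
  · refine ⟨unifAt o d 0 s, fun S hS => ?_, _, hasShape_unifAt hd hs⟩
    rcases hs.eq_or_lt with rfl | hs
    · ring
    · have : ε = 0 := by nlinarith
      rw [this]
      ring
  have hts : 0 < t - s := sub_pos.2 hlt
  have hw₁ : 0 ≤ (1 - ε * t / (t - s)) / (1 - ε) := by
    refine div_nonneg (sub_nonneg.2 ?_) h1'.le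
    rw [div_le_one hts]
    linarith
  have hw₂ : 0 ≤ ε * s / (t - s) / (1 - ε) := by positivity
  have hs1 : (1 - ε * t / (t - s)) / (1 - ε) + ε * s / (t - s) / (1 - ε) + 0 = 1 := by
    field_simp
    ring
  obtain ⟨A, hA⟩ := exists_convexComb hw₁ hw₂ le_rfl hs1 (unifAt o d 0 t) (unifAt o d 0 s)
    (unifAt o d 0 s)
  have sh : HasShape o d 0 t (0 + s) (unifAt o d 0 s) :=
    (hasShape_unifAt hd hs).mono_right hd hlt.le
  refine ⟨A, fun S hS => ?_, _, HasShape.convexComb hd hw₁ hw₂ le_rfl hs1 hA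
    (hasShape_unifAt hd ht) sh sh⟩
  have := unifAt_real_split (o := o) hd hs hlt.le hS
  rw [convexComb_real hw₁ hw₂ le_rfl hA]
  field_simp
  linear_combination ε * this

theorem exists_isMix_left {o d a b y η : ℝ} (hd : 0 < d) (ha : 0 ≤ a) (hab : a ≤ b) (hb : 0 < b)
    (hy : 0 ≤ y) (hy1 : y ≤ 1) (hay : 0 < a ∨ y < 1) (hη : 0 < η) {ν : ProbabilityMeasure ℝ}
    (hν : IsMix y ν (unifAt o d 0 a) (unifAt o d 0 b)) :
    ∃ ε s, 0 < ε ∧ ε < 1 ∧ ε < η ∧ 0 ≤ s ∧ s < η ∧ s ≤ b ∧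
      ∃ A e, IsMix ε ν A (unifAt o d 0 s) ∧ HasShape o d s b e A := by
  rcases ha.eq_or_lt with rfl | ha
  · have hy1 : y < 1 := by simpa using hay
    have hm : 0 < min η 1 := lt_min hη one_pos
    have hm1 : min η 1 ≤ 1 := min_le_right _ _
    have hmη : min η 1 ≤ η := min_le_left _ _
    set ε := min η 1 * (1 - y) / 2 with hε
    have hε0 : 0 < ε := by
      have : 0 < 1 - y := sub_pos.2 hy1
      positivity
    have hεm : ε ≤ min η 1 / 2 := by nlinarith
    have hεy : ε ≤ (1 - y) / 2 := by nlinarith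
    have h1' : 0 < 1 - ε := by linarith
    have hw₁ : 0 ≤ (1 - y - ε) / (1 - ε) := div_nonneg (by linarith) h1'.le
    have hw₂ : 0 ≤ y / (1 - ε) := by positivity
    have hs1 : (1 - y - ε) / (1 - ε) + y / (1 - ε) + 0 = 1 := by
      field_simp
      ring
    obtain ⟨A, hA⟩ := exists_convexComb hw₁ hw₂ le_rfl hs1 (unifAt o d 0 0) (unifAt o d 0 b)
      (unifAt o d 0 b)
    refine ⟨ε, 0, hε0, by linarith, by linarith, le_rfl, hη, hab, A, _, fun S hS => ?_,
      HasShape.convexComb hd hw₁ hw₂ le_rfl hs1 hA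
        ((hasShape_unifAt hd le_rfl).mono_right hd hab)
        (hasShape_unifAt hd hab) (hasShape_unifAt hd hab)⟩
    rw [convexComb_real hw₁ hw₂ le_rfl hA, hν S hS]
    field_simp
    ring
  · set h0 := (1 - y) / a + y / b with hh0
    have hh0p : 0 < h0 := by
      rcases hy.eq_or_lt with rfl | hy
      · rw [hh0]
        simpa using ha
      · have : 0 ≤ 1 - y := sub_nonneg.2 hy1
        positivity
    set k := min a (min η 1) with hk
    have hk0 : 0 < k := lt_min ha (lt_min hη one_pos)
    have hka : k ≤ a := min_le_left _ _
    have hkη : k ≤ η := (min_le_right _ _).trans (min_le_left _ _)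
    have hk1 : k ≤ 1 := (min_le_right _ _).trans (min_le_right _ _)
    set s := k / (1 + h0) with hs
    have hs0 : 0 < s := by positivity
    have hsk : s * (1 + h0) = k := by
      rw [hs]
      field_simp
    have hsk' : s < k := by nlinarith
    set ε := s * h0 with hε
    have hεk : ε < k := by nlinarith
    have hε0 : 0 < ε := by positivity
    have h1' : 0 < 1 - ε := by linarith
    have has : 0 < a - s := by linarith
    have hbs : 0 < b - s := by linarith
    have hw₁ : 0 ≤ (1 - y) * (a - s) / a / (1 - ε) := by
      have : 0 ≤ 1 - y := sub_nonneg.2 hy1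
      positivity
    have hw₂ : 0 ≤ y * (b - s) / b / (1 - ε) := by positivity
    have hεe : ε * (a * b) = s * ((1 - y) * b + y * a) := by
      rw [hε, hh0]
      field_simp
    have hs1 : (1 - y) * (a - s) / a / (1 - ε) + y * (b - s) / b / (1 - ε) + 0 = 1 := by
      field_simp
      linear_combination hεe
    obtain ⟨A, hA⟩ := exists_convexComb hw₁ hw₂ le_rfl hs1 (unifAt o d s a) (unifAt o d s b)
      (unifAt o d s b)
    refine ⟨ε, s, hε0, by linarith, by linarith, hs0.le, by linarith, by linarith, A, _,
      fun S hS => ?_, HasShape.convexComb hd hw₁ hw₂ le_rfl hs1 hA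
        ((hasShape_unifAt hd (by linarith)).mono_right hd hab)
        (hasShape_unifAt hd (by linarith)) (hasShape_unifAt hd (by linarith))⟩
    have e₁ := unifAt_real_split (o := o) hd hs0.le (by linarith : s ≤ a) hS
    have e₂ := unifAt_real_split (o := o) hd hs0.le (by linarith : s ≤ b) hS
    rw [convexComb_real hw₁ hw₂ le_rfl hA, hν S hS]
    field_simp
    linear_combination (1 - y) * b * e₁ + a * y * e₂ -
      (unifAt o d 0 s : Measure ℝ).real S * hεe

theorem exists_isMix_right {o d a b c y s : ℝ} (hd : 0 < d) (ha : 0 ≤ a) (hab : a ≤ b)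
    (hc : 0 ≤ c) (hcb : c < b) (hy1 : y ≤ 1) (hs : 0 ≤ s) (hs1 : s < 1)
    (hsy : s * b ≤ y * (b - c)) {ν : ProbabilityMeasure ℝ}
    (hν : IsMix y ν (unifAt o d 0 a) (unifAt o d 0 b)) :
    ∃ A e, IsMix s ν A (unifAt o d c b) ∧ HasShape o d 0 b e A := by
  have h1' : 0 < 1 - s := sub_pos.2 hs1
  have hbc : 0 < b - c := sub_pos.2 hcb
  have hw₁ : 0 ≤ (1 - y) / (1 - s) := div_nonneg (by linarith) h1'.le
  have hw₂ : 0 ≤ (y - s * b / (b - c)) / (1 - s) := by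
    refine div_nonneg (sub_nonneg.2 ?_) h1'.le
    rwa [div_le_iff₀ hbc]
  have hw₃ : 0 ≤ s * c / (b - c) / (1 - s) := by positivity
  have hw : (1 - y) / (1 - s) + (y - s * b / (b - c)) / (1 - s) + s * c / (b - c) / (1 - s)
      = 1 := by
    field_simp
    ring
  obtain ⟨A, hA⟩ := exists_convexComb hw₁ hw₂ hw₃ hw (unifAt o d 0 a) (unifAt o d 0 b)
    (unifAt o d 0 c)
  refine ⟨A, _, fun S hS => ?_, HasShape.convexComb hd hw₁ hw₂ hw₃ hw hA
    ((hasShape_unifAt hd ha).mono_right hd hab) (hasShape_unifAt hd (ha.trans hab))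
    ((hasShape_unifAt hd hc).mono_right hd hcb.le)⟩
  have e := unifAt_real_split (o := o) hd hc hcb.le hS
  rw [convexComb_real hw₁ hw₂ hw₃ hA, hν S hS]
  field_simp
  linear_combination s * e

theorem exists_isMix_right_of_eq {o d a b c y s : ℝ} (hd : 0 < d) (ha : 0 ≤ a) (hac : a ≤ c)
    (hcb : c < b) (hy1 : y ≤ 1) (hs : 0 ≤ s) (hs1 : s < 1)
    (hsy : s * b = y * (b - c)) {ν : ProbabilityMeasure ℝ}
    (hν : IsMix y ν (unifAt o d 0 a) (unifAt o d 0 b)) :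
    ∃ A e, IsMix s ν A (unifAt o d c b) ∧ HasShape o d 0 c e A := by
  have h1' : 0 < 1 - s := sub_pos.2 hs1
  have hbc : 0 < b - c := sub_pos.2 hcb
  have hc : 0 ≤ c := ha.trans hac
  have hw₁ : 0 ≤ (1 - y) / (1 - s) := div_nonneg (by linarith) h1'.le
  have hw₃ : 0 ≤ (y - s) / (1 - s) := by
    refine div_nonneg ?_ h1'.le
    nlinarith
  have hw : (1 - y) / (1 - s) + (y - s) / (1 - s) + 0 = 1 := by
    field_simp
    ring
  obtain ⟨A, hA⟩ := exists_convexComb hw₁ hw₃ le_rfl hw (unifAt o d 0 a) (unifAt o d 0 c)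
    (unifAt o d 0 c)
  refine ⟨A, _, fun S hS => ?_, HasShape.convexComb hd hw₁ hw₃ le_rfl hw hA
    ((hasShape_unifAt hd ha).mono_right hd hac) (hasShape_unifAt hd hc) (hasShape_unifAt hd hc)⟩
  have e := unifAt_real_split (o := o) hd hc hcb.le hS
  rw [convexComb_real hw₁ hw₃ le_rfl hA, hν S hS]
  have hb : b ≠ 0 := by linarith
  field_simp
  apply mul_left_cancel₀ hb
  linear_combination y * e + ((unifAt o d 0 c : Measure ℝ).real S -
    (unifAt o d c b : Measure ℝ).real S) * hsy

theorem IsMix.hasShape {o d u v e₁ e₂ ε : ℝ} (hd : 0 < d) (h0 : 0 ≤ ε) (h1 : ε ≤ 1)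
    {ν A B : ProbabilityMeasure ℝ} (h : IsMix ε ν A B) (s₁ : HasShape o d u v e₁ A)
    (s₂ : HasShape o d u v e₂ B) : HasShape o d u v ((1 - ε) * e₁ + ε * e₂) ν := by
  have hM : (ν : Measure ℝ) = ENNReal.ofReal (1 - ε) • (A : Measure ℝ) +
      ENNReal.ofReal ε • (B : Measure ℝ) + ENNReal.ofReal 0 • (B : Measure ℝ) := by
    rw [h.measure_eq h0 h1]
    simp
  simpa using HasShape.convexComb hd (sub_nonneg.2 h1) h0 le_rfl (by ring) hM s₁ s₂ s₂

theorem exists_sum_eq_of_sum_le {ι : Type*} (F : Finset ι) {L U : ι → ℝ} {S : ℝ}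
    (hLU : ∀ k ∈ F, L k ≤ U k) (hL : ∑ k ∈ F, L k ≤ S) (hU : S ≤ ∑ k ∈ F, U k) :
    ∃ s : ι → ℝ, (∀ k ∈ F, L k ≤ s k ∧ s k ≤ U k) ∧ ∑ k ∈ F, s k = S := by
  rcases (hL.trans hU).eq_or_lt with he | hlt
  · exact ⟨L, fun k hk => ⟨le_rfl, hLU k hk⟩, by linarith⟩
  · have hD : 0 < ∑ k ∈ F, U k - ∑ k ∈ F, L k := sub_pos.2 hlt
    set θ := (S - ∑ k ∈ F, L k) / (∑ k ∈ F, U k - ∑ k ∈ F, L k) with hθ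
    have hθ0 : 0 ≤ θ := div_nonneg (sub_nonneg.2 hL) hD.le
    have hθ1 : θ ≤ 1 := by
      rw [hθ, div_le_one hD]
      linarith
    refine ⟨fun k => L k + θ * (U k - L k), fun k hk => ?_, ?_⟩
    · have := hLU k hk
      constructor <;> nlinarith
    · rw [Finset.sum_add_distrib, ← Finset.mul_sum, Finset.sum_sub_distrib, hθ,
        div_mul_cancel₀ _ hD.ne']
      ring

theorem sum_max_le {ι : Type*} (F : Finset ι) {t : ι → ℝ} {S : ℝ} (h0 : ∀ k ∈ F, 0 ≤ t k)
    (h1 : ∀ k ∈ F, t k ≤ 1) (hS0 : 0 ≤ S) (hS1 : S ≤ 1) (ht : ∑ k ∈ F, t k ≤ 2 - S) :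
    ∑ k ∈ F, max 0 (t k - 1 + S) ≤ S := by
  classical
  set M := F.filter fun k => 0 < t k - 1 + S with hM
  have e : ∑ k ∈ F, max 0 (t k - 1 + S) = ∑ k ∈ M, (t k - 1 + S) := by
    rw [hM, Finset.sum_filter]
    refine Finset.sum_congr rfl fun k _ => ?_
    split_ifs with h
    · exact max_eq_right h.le
    · exact max_eq_left (not_lt.1 h)
  have e2 : ∑ k ∈ M, (t k - 1 + S) = ∑ k ∈ M, t k - M.card * (1 - S) := by
    rw [Finset.sum_add_distrib, Finset.sum_sub_distrib]
    simp
    ring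
  have h2 : ∑ k ∈ M, t k ≤ ∑ k ∈ F, t k :=
    Finset.sum_le_sum_of_subset_of_nonneg (Finset.filter_subset _ _) fun k hk _ => h0 k hk
  rw [e]
  rcases lt_or_ge M.card 2 with hc | hc
  · have h3 : ∑ k ∈ M, t k ≤ M.card := by
      have := Finset.sum_le_card_nsmul M t 1 fun k hk => h1 k (Finset.mem_filter.1 hk).1
      simpa using this
    rw [e2]
    have hc' : (M.card : ℝ) ≤ 1 := by exact_mod_cast Nat.lt_succ_iff.1 hc
    nlinarith
  · rw [e2]
    have hc' : (2 : ℝ) ≤ M.card := by exact_mod_cast hc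
    nlinarith

/-- The tuple `ν` cannot be split into two tuples, each of decreasing measures with compatible
boundary, in the coordinates `t ↦ o k + d * t`. -/
def IsRigid {N : ℕ} (o : Fin N → ℝ) (d : ℝ) (ν : Fin N → ProbabilityMeasure ℝ) : Prop :=
  ∀ (ε : ℝ) (A B : Fin N → ProbabilityMeasure ℝ) (uA vA uB vB eB : Fin N → ℝ), 0 < ε → ε < 1 →
    (∀ k, IsMix ε (ν k) (A k) (B k)) → (∀ k, ∃ e, HasShape (o k) d (uA k) (vA k) e (A k)) →
    (∀ k, HasShape (o k) d (uB k) (vB k) (eB k) (B k)) →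
    (∀ k, vA k - uA k ≤ 1 - ∑ i, uA i) → (∀ k, vB k - uB k ≤ 1 - ∑ i, uB i) →
    ∑ k, eB k = 2 → ν = B

section

variable {N : ℕ} {o : Fin N → ℝ} {d : ℝ} {ν : Fin N → ProbabilityMeasure ℝ}

theorem not_isRigid_of_unif_one (hd : 0 < d) {t : Fin N → ℝ} (ht0 : ∀ k, 0 ≤ t k)
    (hν : ∀ k, ν k = unifAt (o k) d 0 (t k)) (hsum : ∑ k, t k = 2) {i : Fin N} (hi : t i = 1) :
    ¬ IsRigid o d ν := by
  intro H
  have hti : ∀ k, k ≠ i → t k ≤ 1 := fun k hk => by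
    have := Finset.add_sum_erase Finset.univ t (Finset.mem_univ i)
    have h2 := Finset.single_le_sum (f := t) (s := Finset.univ.erase i) (fun k _ => ht0 k)
      (Finset.mem_erase.2 ⟨hk, Finset.mem_univ k⟩)
    linarith
  have key : ∀ k, IsMix (1 / 2) (unifAt (o k) d 0 (t k)) (unifAt (o k) d 0 (t k / 2))
      (unifAt (o k) d (t k / 2) (t k)) := fun k => by
    have := isMix_unifAt_of_eq (o := o k) hd (ht0 k) (by norm_num : (0 : ℝ) ≤ 1 / 2)
      (by norm_num)
    have e : (1 - 1 / 2 : ℝ) * t k = t k / 2 := by ring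
    rwa [e] at this
  have hB := H (1 / 2)
    (fun k => if k = i then unifAt (o k) d (1 / 2) 1 else unifAt (o k) d 0 (t k / 2))
    (fun k => if k = i then unifAt (o k) d 0 (1 / 2) else unifAt (o k) d (t k / 2) (t k))
    (fun k => if k = i then 1 / 2 else 0) (fun k => if k = i then 1 else t k / 2)
    (fun k => t k / 2 - if k = i then 1 / 2 else 0) (fun k => t k - if k = i then 1 / 2 else 0)
    (fun k => t k / 2 + t k - if k = i then 1 else 0) (by norm_num) (by norm_num)
    ?_ ?_ ?_ ?_ ?_ ?_
  · have := congrFun hB i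
    simp only [if_true] at this
    have s₁ := hasShape_unifAt (o := o i) (v := 1) hd zero_le_one
    have s₂ := hasShape_unifAt (o := o i) (u := 0) (v := 1 / 2) hd (by norm_num)
    rw [← this, hν i, hi] at s₂
    have := s₁.unique hd s₂
    norm_num at this
  · intro k
    rw [hν k]
    split_ifs with h
    · subst h
      have := key k
      rw [hi] at this ⊢
      intro S hS
      rw [this S hS]
      ring
    · exact key k
  · intro k
    split_ifs with h
    · exact ⟨_, hasShape_unifAt hd (by norm_num)⟩
    · exact ⟨_, hasShape_unifAt hd (by linarith [ht0 k])⟩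
  · intro k
    split_ifs with h
    · subst h
      rw [hi]
      convert hasShape_unifAt (o := o k) (u := 0) (v := 1 / 2) hd (by norm_num) using 1 <;> norm_num
    · convert hasShape_unifAt (o := o k) (u := t k / 2) (v := t k) hd (by linarith [ht0 k]) using 1
        <;> ring
  · intro k
    rw [Finset.sum_ite_eq' Finset.univ i]
    simp only [Finset.mem_univ, if_true]
    split_ifs with h
    · norm_num
    · linarith [hti k h]
  · intro k
    rw [Finset.sum_sub_distrib, Finset.sum_ite_eq' Finset.univ i, ← Finset.sum_div, hsum]
    simp only [Finset.mem_univ, if_true]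
    split_ifs with h
    · subst h
      linarith
    · linarith [hti k h]
  · rw [Finset.sum_sub_distrib, Finset.sum_add_distrib, Finset.sum_ite_eq' Finset.univ i,
      ← Finset.sum_div, hsum]
    norm_num

theorem not_isRigid_of_lt_one (hd : 0 < d) {j : Fin N} {t : Fin N → ℝ}
    (ht0 : ∀ k, k ≠ j → 0 ≤ t k) (ht1 : ∀ k, k ≠ j → t k < 1)
    (hν : ∀ k, k ≠ j → ν k = unifAt (o k) d 0 (t k)) {a b y m : ℝ} (ha : 0 ≤ a) (hab : a ≤ b)
    (hb : b ≤ 1) (hy : 0 ≤ y) (hy1 : y ≤ 1) (hay : 0 < a ∨ y < 1)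
    (hj : IsMix y (ν j) (unifAt (o j) d 0 a) (unifAt (o j) d 0 b))
    (hm : (1 - y) * a + y * b = m) (hm0 : 0 < m) (hm1 : m < 1)
    (hsum : m + ∑ k ∈ Finset.univ.erase j, t k = 2) : ¬ IsRigid o d ν := by
  intro H
  have hb0 : 0 < b := by nlinarith
  have hE : ∀ᶠ η in nhdsWithin (0 : ℝ) (Ioi 0), η < 1 - m ∧ η < m ∧ ∀ k, k ≠ j → η < 1 - t k := by
    have : ∀ {c : ℝ}, 0 < c → ∀ᶠ η in nhdsWithin (0 : ℝ) (Ioi 0), η < c := fun hc =>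
      nhdsWithin_le_nhds (eventually_lt_nhds hc)
    refine (this (sub_pos.2 hm1)).and ((this hm0).and ?_)
    rw [Filter.eventually_all]
    intro k
    by_cases hk : k = j
    · simp [hk]
    · filter_upwards [this (sub_pos.2 (ht1 k hk))] with η hη _ using hη
  obtain ⟨η, ⟨hη1, hη2, hη3⟩, hη⟩ := (hE.and self_mem_nhdsWithin).exists
  obtain ⟨ε, s, hε0, hε1, hεη, hs0, hsη, hsb, Aj, ej, hmix, hAj⟩ :=
    exists_isMix_left hd ha hab hb0 hy hy1 hay hη hj
  have memF : ∀ {k}, k ∈ Finset.univ.erase j → k ≠ j := fun hk => Finset.ne_of_mem_erase hk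
  obtain ⟨σ, hσ, hσs⟩ := exists_sum_eq_of_sum_le (Finset.univ.erase j)
    (L := fun k => max 0 (t k - 1 + (m - s))) (U := fun k => (1 - ε) * t k) (S := m - s)
    (fun k hk => max_le (mul_nonneg (by linarith) (ht0 k (memF hk)))
      (by nlinarith [ht0 k (memF hk), ht1 k (memF hk)]))
    (sum_max_le _ (fun k hk => ht0 k (memF hk)) (fun k hk => (ht1 k (memF hk)).le)
      (by linarith) (by linarith) (by linarith))
    (by rw [← Finset.mul_sum]; nlinarith)
  have memF' : ∀ {k}, k ≠ j → k ∈ Finset.univ.erase j := fun hk =>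
    Finset.mem_erase.2 ⟨hk, Finset.mem_univ _⟩
  have hσ0 : ∀ k, k ≠ j → 0 ≤ σ k := fun k hk => (le_max_left _ _).trans (hσ k (memF' hk)).1
  have hσL : ∀ k, k ≠ j → t k - 1 + (m - s) ≤ σ k := fun k hk =>
    (le_max_right _ _).trans (hσ k (memF' hk)).1
  have hσU : ∀ k, k ≠ j → σ k ≤ (1 - ε) * t k := fun k hk => (hσ k (memF' hk)).2
  have hσt : ∀ k, k ≠ j → σ k ≤ t k := fun k hk => by
    nlinarith [hσU k hk, ht0 k hk]
  have hA : ∀ k, ∃ A, k ≠ j → IsMix ε (ν k) A (unifAt (o k) d (σ k) (t k)) ∧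
      ∃ e, HasShape (o k) d 0 (t k) e A := fun k => by
    by_cases hk : k = j
    · exact ⟨ν k, fun h => absurd hk h⟩
    · obtain ⟨A, h⟩ := exists_isMix_unifAt (o := o k) hd (ht0 k hk) hε0.le hε1 (hσ0 k hk) (hσU k hk)
      exact ⟨A, fun _ => by rwa [hν k hk]⟩
  choose A hA using hA
  have sumite : ∀ (c : ℝ) (f : Fin N → ℝ), ∑ k, (if k = j then c else f k) =
      c + ∑ k ∈ Finset.univ.erase j, f k := fun c f => by
    rw [← Finset.add_sum_erase Finset.univ _ (Finset.mem_univ j), if_pos rfl]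
    congr 1
    exact Finset.sum_congr rfl fun k hk => if_neg (memF hk)
  have hB := H ε (fun k => if k = j then Aj else A k)
    (fun k => if k = j then unifAt (o k) d 0 s else unifAt (o k) d (σ k) (t k))
    (fun k => if k = j then s else 0) (fun k => if k = j then b else t k)
    (fun k => if k = j then 0 else σ k) (fun k => if k = j then s else t k)
    (fun k => if k = j then s else σ k + t k) hε0 hε1 ?_ ?_ ?_ ?_ ?_ ?_
  · have := congrFun hB j
    simp only [if_true] at this
    have s₁ := hj.hasShape hd hy hy1 ((hasShape_unifAt hd ha).mono_right hd hab)
      (hasShape_unifAt hd (ha.trans hab))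
    have s₂ := hasShape_unifAt (o := o j) hd hs0
    rw [← this] at s₂
    have := s₁.unique hd s₂
    linarith
  · intro k
    split_ifs with h
    · subst h
      exact hmix
    · exact (hA k h).1
  · intro k
    split_ifs with h
    · subst h
      exact ⟨_, hAj⟩
    · exact (hA k h).2
  · intro k
    split_ifs with h
    · subst h
      simpa using hasShape_unifAt (o := o k) hd hs0
    · exact hasShape_unifAt hd (hσt k h)
  · intro k
    rw [sumite]
    simp only [Finset.sum_const_zero, add_zero]
    split_ifs with h
    · linarith
    · linarith [hη3 k h]
  · intro k
    rw [sumite, hσs]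
    split_ifs with h
    · linarith
    · linarith [hσL k h]
  · rw [sumite, Finset.sum_add_distrib, hσs]
    linarith

theorem not_isRigid_of_one_aux (hd : 0 < d) {i j : Fin N} (hij : i ≠ j) {t : Fin N → ℝ}
    (ht0 : ∀ k, k ≠ i → k ≠ j → 0 ≤ t k)
    (hν : ∀ k, k ≠ i → k ≠ j → ν k = unifAt (o k) d 0 (t k)) (hi : ν i = unifAt (o i) d 0 1)
    {b c m s v e : ℝ} (hs0 : 0 < s) (hs1 : s < 1) (hc0 : 0 ≤ c) (hcb : c < b) (hb : b ≤ 1)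
    (hcm : c = m - s) (hmb : m < b) (hbm : 1 - b ≤ (1 - s) * (1 - m)) (hv : v ≤ 1 - s)
    {Aj : ProbabilityMeasure ℝ} (hmix : IsMix s (ν j) Aj (unifAt (o j) d c b))
    (hAj : HasShape (o j) d 0 v e Aj)
    (hsum : ∑ k ∈ (Finset.univ.erase i).erase j, t k = 1 - m) : ¬ IsRigid o d ν := by
  intro H
  have memF : ∀ {k}, k ∈ (Finset.univ.erase i).erase j → k ≠ i ∧ k ≠ j := fun hk =>
    ⟨Finset.ne_of_mem_erase (Finset.mem_of_mem_erase hk), Finset.ne_of_mem_erase hk⟩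
  have htT : ∀ k, k ≠ i → k ≠ j → t k ≤ 1 - m := fun k h1 h2 => by
    rw [← hsum]
    exact Finset.single_le_sum (f := t) (fun k hk => ht0 k (memF hk).1 (memF hk).2)
      (Finset.mem_erase.2 ⟨h2, Finset.mem_erase.2 ⟨h1, Finset.mem_univ k⟩⟩)
  have hT : 0 < 1 - m := by linarith
  set r := (1 - b) / (1 - m) with hr
  have hr0 : 0 ≤ r := div_nonneg (by linarith) hT.le
  have hrT : r * (1 - m) = 1 - b := div_mul_cancel₀ _ hT.ne'
  have hrs : r ≤ 1 - s := by
    rw [hr, div_le_iff₀ hT]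
    exact hbm
  have hA : ∀ k, ∃ A, k ≠ i → k ≠ j → IsMix s (ν k) A (unifAt (o k) d (r * t k) (t k)) ∧
      ∃ e, HasShape (o k) d 0 (t k) e A := fun k => by
    by_cases hk : k ≠ i ∧ k ≠ j
    · have h0 := ht0 k hk.1 hk.2
      obtain ⟨A, h⟩ := exists_isMix_unifAt (o := o k) hd h0 hs0.le hs1
        (mul_nonneg hr0 h0) (mul_le_mul_of_nonneg_right hrs h0)
      exact ⟨A, fun _ _ => by rwa [hν k hk.1 hk.2]⟩
    · exact ⟨ν k, fun h1 h2 => absurd ⟨h1, h2⟩ hk⟩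
  choose A hA using hA
  have sumite : ∀ (c c' : ℝ) (f : Fin N → ℝ),
      ∑ k, (if k = i then c else if k = j then c' else f k) =
      c + (c' + ∑ k ∈ (Finset.univ.erase i).erase j, f k) := fun c c' f => by
    rw [← Finset.add_sum_erase Finset.univ _ (Finset.mem_univ i), if_pos rfl,
      ← Finset.add_sum_erase (Finset.univ.erase i) _
        (Finset.mem_erase.2 ⟨hij.symm, Finset.mem_univ j⟩), if_neg hij.symm, if_pos rfl]
    congr 2
    exact Finset.sum_congr rfl fun k hk => by rw [if_neg (memF hk).1, if_neg (memF hk).2]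
  have hB := H s
    (fun k => if k = i then unifAt (o k) d s 1 else if k = j then Aj else A k)
    (fun k => if k = i then unifAt (o k) d 0 s else if k = j then unifAt (o k) d c b else
      unifAt (o k) d (r * t k) (t k))
    (fun k => if k = i then s else if k = j then 0 else 0)
    (fun k => if k = i then 1 else if k = j then v else t k)
    (fun k => if k = i then 0 else if k = j then c else r * t k)
    (fun k => if k = i then s else if k = j then b else t k)
    (fun k => if k = i then s else if k = j then c + b else r * t k + t k)
    hs0 hs1 ?_ ?_ ?_ ?_ ?_ ?_
  · have := congrFun hB i
    simp only [if_true] at this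
    have s₁ := hasShape_unifAt (o := o i) (v := 1) hd zero_le_one
    have s₂ := hasShape_unifAt (o := o i) hd hs0.le
    rw [← this, hi] at s₂
    have := s₁.unique hd s₂
    linarith
  · intro k
    split_ifs with h h'
    · subst h
      rw [hi]
      intro S hS
      have := unifAt_real_split (o := o k) hd hs0.le hs1.le hS
      linarith
    · subst h'
      exact hmix
    · exact (hA k h h').1
  · intro k
    split_ifs with h h'
    · exact ⟨_, hasShape_unifAt hd hs1.le⟩
    · subst h'
      exact ⟨_, hAj⟩
    · exact (hA k h h').2
  · intro k
    split_ifs with h h'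
    · simpa using hasShape_unifAt (o := o k) hd hs0.le
    · exact hasShape_unifAt hd hcb.le
    · exact hasShape_unifAt hd (by nlinarith [ht0 k h h'])
  · intro k
    rw [sumite]
    simp only [Finset.sum_const_zero, add_zero]
    split_ifs with h h'
    · exact le_rfl
    · linarith
    · linarith [htT k h h']
  · intro k
    rw [sumite, ← Finset.mul_sum, hsum, hrT]
    split_ifs with h h'
    · linarith
    · linarith
    · nlinarith [htT k h h', ht0 k h h']
  · rw [sumite, Finset.sum_add_distrib, ← Finset.mul_sum, hsum, hrT]
    linarith

theorem not_isRigid_of_one (hd : 0 < d) {i j : Fin N} (hij : i ≠ j) {t : Fin N → ℝ}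
    (ht0 : ∀ k, k ≠ i → k ≠ j → 0 ≤ t k)
    (hν : ∀ k, k ≠ i → k ≠ j → ν k = unifAt (o k) d 0 (t k)) (hi : ν i = unifAt (o i) d 0 1)
    {a b y m : ℝ} (ha : 0 ≤ a) (hab : a < b) (hb : b ≤ 1) (hy : 0 < y) (hy1 : y < 1)
    (hj : IsMix y (ν j) (unifAt (o j) d 0 a) (unifAt (o j) d 0 b))
    (hm : (1 - y) * a + y * b = m)
    (hsum : ∑ k ∈ (Finset.univ.erase i).erase j, t k = 1 - m) : ¬ IsRigid o d ν := by
  have ham : a < m := by nlinarith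
  have hmb : m < b := by nlinarith
  rcases hb.eq_or_lt with rfl | hb1
  · have hs0 : 0 < y * (1 - a) := mul_pos hy (sub_pos.2 hab)
    have hs1 : y * (1 - a) < 1 := by nlinarith
    obtain ⟨A, e, hmix, hA⟩ := exists_isMix_right_of_eq (c := a) (s := y * (1 - a)) hd ha le_rfl hab
      hy1.le hs0.le hs1 (by ring) hj
    exact not_isRigid_of_one_aux hd hij ht0 hν hi hs0 hs1 ha hab le_rfl (by linarith) hmb
      (by nlinarith) (by nlinarith) hmix hA hsum
  · have hE : ∃ s, 0 < s ∧ s < m - a ∧ s < y * (b - m) ∧ s < 1 - b := by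
      have : ∀ {c : ℝ}, 0 < c → ∀ᶠ η in nhdsWithin (0 : ℝ) (Ioi 0), η < c := fun hc =>
        nhdsWithin_le_nhds (eventually_lt_nhds hc)
      exact ((eventually_mem_nhdsWithin (α := ℝ) (a := 0) (s := Ioi 0)).and
        ((this (sub_pos.2 ham)).and ((this (mul_pos hy (sub_pos.2 hmb))).and
          (this (sub_pos.2 hb1))))).exists
    obtain ⟨s, hs0, hs1, hs2, hs3⟩ := hE
    have hsb : s < b - m := by nlinarith
    obtain ⟨A, e, hmix, hA⟩ := exists_isMix_right (c := m - s) (s := s) hd ha hab.le (by linarith)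
      (by linarith) hy1.le hs0.le (by linarith) (by nlinarith) hj
    exact not_isRigid_of_one_aux hd hij ht0 hν hi hs0 (by linarith) (by linarith) (by linarith) hb
      rfl hmb (by nlinarith) (by linarith) hmix hA hsum

end

theorem exists_antitone_rightContinuous {g : ℝ → ℝ≥0∞} (hg : Antitone g) :
    ∃ f : ℝ → ℝ≥0∞, Antitone f ∧ (∀ x v, v < f x → ∃ y, x < y ∧ v < f y) ∧ (∀ x, f x ≤ g x) ∧
      f =ᵐ[volume] g := by
  refine ⟨fun x => ⨆ y ∈ Ioi x, g y, fun x x' hx => ?_, fun x v hv => ?_, fun x => ?_, ?_⟩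
  · exact biSup_mono fun y hy => lt_of_le_of_lt hx hy
  · simp only [lt_iSup_iff] at hv
    obtain ⟨y, hy, hvy⟩ := hv
    obtain ⟨z, hz, hzy⟩ := exists_between (mem_Ioi.1 hy)
    exact ⟨z, hz, lt_of_lt_of_le hvy (le_iSup₂_of_le y hzy le_rfl)⟩
  · exact iSup₂_le fun y hy => hg (mem_Ioi.1 hy).le
  · have hc : {x | ¬ContinuousAt g x}.Countable := hg.countable_not_continuousAt
    filter_upwards [hc.ae_notMem volume] with x hx
    have hx : ContinuousAt g x := by simpa using hx
    refine le_antisymm (iSup₂_le fun y hy => hg (mem_Ioi.1 hy).le) ?_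
    refine le_of_tendsto (hx.tendsto.mono_left (nhdsWithin_le_nhds (s := Ioi x))) ?_
    filter_upwards [self_mem_nhdsWithin] with y hy
    exact le_iSup₂_of_le y hy le_rfl

/-- The measure with an atom of mass `p` at `l` and density `g` on `(l, ∞)`. -/
noncomputable def atomDensity (l : ℝ) (p : ℝ≥0∞) (g : ℝ → ℝ≥0∞) : Measure ℝ :=
  p • Measure.dirac l + (volume.restrict (Ioi l)).withDensity g

theorem atomDensity_add {l : ℝ} {p q : ℝ≥0∞} {f g : ℝ → ℝ≥0∞} (hf : Measurable f) :
    atomDensity l (p + q) (f + g) = atomDensity l p f + atomDensity l q g := by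
  unfold atomDensity
  rw [withDensity_add_left hf, add_smul]
  abel

theorem isDec_atomDensity {l r : ℝ} {p : ℝ≥0∞} {g : ℝ → ℝ≥0∞} (hg : Antitone g)
    (h : ∀ x, r < x → g x = 0) : IsDec l r (atomDensity l p g) := ⟨p, g, hg, h, rfl⟩

theorem atomDensity_Ioi_eq_zero {l y : ℝ} {p : ℝ≥0∞} {g : ℝ → ℝ≥0∞} (hly : l ≤ y)
    (h : ∀ x, y < x → g x = 0) : atomDensity l p g (Ioi y) = 0 := by
  unfold atomDensity
  rw [Measure.add_apply, Measure.smul_apply, Measure.dirac_apply' _ measurableSet_Ioi,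
    withDensity_apply _ measurableSet_Ioi, setLIntegral_congr_fun measurableSet_Ioi
      (g := fun _ => 0) (fun x hx => h x hx)]
  simp [hly]

theorem atomDensity_Ioi_ne_zero {l y z : ℝ} {p : ℝ≥0∞} {g : ℝ → ℝ≥0∞} (hg : Antitone g)
    (hly : l ≤ y) (hyz : y < z) (h : g z ≠ 0) : atomDensity l p g (Ioi y) ≠ 0 := by
  have h1 : (volume.restrict (Ioi l)).withDensity g (Ioi y) ≤ atomDensity l p g (Ioi y) :=
    Measure.le_add_left le_rfl _
  have h2 : g z * volume (Ioc y z) ≤ (volume.restrict (Ioi l)).withDensity g (Ioi y) := by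
    rw [withDensity_apply _ measurableSet_Ioi, Measure.restrict_restrict measurableSet_Ioi,
      inter_eq_left.2 (Ioi_subset_Ioi hly)]
    refine le_trans ?_ (lintegral_mono_set (Ioc_subset_Ioi_self (a := z)))
    rw [← setLIntegral_const]
    exact setLIntegral_mono' measurableSet_Ioc fun x hx => hg hx.2
  have h3 : g z * volume (Ioc y z) ≠ 0 := mul_ne_zero h (by simp [hyz])
  exact fun h0 => h3 (le_antisymm ((h2.trans h1).trans h0.le) bot_le)

theorem exists_probability_smul_eq {l r : ℝ} {P : Measure ℝ} (h : IsDec l r P)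
    (h0 : P univ ≠ 0) (ht : P univ ≠ ⊤) :
    ∃ M : ProbabilityMeasure ℝ, IsDec l r (M : Measure ℝ) ∧ P = P univ • (M : Measure ℝ) := by
  refine ⟨⟨(P univ)⁻¹ • P, ⟨?_⟩⟩, h.smul _, ?_⟩
  · rw [Measure.smul_apply, smul_eq_mul, ENNReal.inv_mul_cancel h0 ht]
  · change P = P univ • ((P univ)⁻¹ • P)
    rw [smul_smul, ENNReal.mul_inv_cancel h0 ht, one_smul]

theorem toReal_weights {c₁ c₂ c₃ : ℝ≥0∞} {ν ν₁ ν₂ ν₃ : ProbabilityMeasure ℝ}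
    (h : (ν : Measure ℝ) = c₁ • (ν₁ : Measure ℝ) + c₂ • (ν₂ : Measure ℝ) + c₃ • (ν₃ : Measure ℝ)) :
    c₁.toReal + c₂.toReal + c₃.toReal = 1 ∧ (ν : Measure ℝ) =
      ENNReal.ofReal c₁.toReal • (ν₁ : Measure ℝ) + ENNReal.ofReal c₂.toReal • (ν₂ : Measure ℝ) +
      ENNReal.ofReal c₃.toReal • (ν₃ : Measure ℝ) := by
  have hs : c₁ + c₂ + c₃ = 1 := by
    have := congrArg (fun ν : Measure ℝ => ν univ) h
    simpa using this.symm
  have h12 : c₁ + c₂ ≠ ⊤ := ne_top_of_le_ne_top ENNReal.one_ne_top (hs ▸ le_self_add)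
  have h1 : c₁ ≠ ⊤ := ne_top_of_le_ne_top h12 le_self_add
  have h2 : c₂ ≠ ⊤ := ne_top_of_le_ne_top h12 le_add_self
  have h3 : c₃ ≠ ⊤ := ne_top_of_le_ne_top ENNReal.one_ne_top (hs ▸ le_add_self)
  refine ⟨?_, ?_⟩
  · rw [← ENNReal.toReal_add h1 h2, ← ENNReal.toReal_add h12 h3, hs, ENNReal.toReal_one]
  · rwa [ENNReal.ofReal_toReal h1, ENNReal.ofReal_toReal h2, ENNReal.ofReal_toReal h3]

theorem exists_isMix_of_eq {c₁ c₂ : ℝ≥0∞} (h₁ : c₁ ≠ 0) (h₂ : c₂ ≠ 0)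
    {ν A B : ProbabilityMeasure ℝ}
    (h : (ν : Measure ℝ) = c₁ • (A : Measure ℝ) + c₂ • (B : Measure ℝ)) :
    ∃ w, 0 < w ∧ w < 1 ∧ IsMix w ν A B := by
  obtain ⟨hs, he⟩ := toReal_weights (c₃ := 0) (ν₃ := B) (by simpa using h)
  have hs' : c₁.toReal + c₂.toReal = 1 := by simpa using hs
  have ht : c₁ + c₂ = 1 := by
    have := congrArg (fun ν : Measure ℝ => ν univ) h
    simpa using this.symm
  have p₁ : 0 < c₁.toReal := ENNReal.toReal_pos h₁
    (ne_top_of_le_ne_top ENNReal.one_ne_top (ht ▸ le_self_add))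
  have p₂ : 0 < c₂.toReal := ENNReal.toReal_pos h₂
    (ne_top_of_le_ne_top ENNReal.one_ne_top (ht ▸ le_add_self))
  refine ⟨c₂.toReal, p₂, by linarith, fun S _ => ?_⟩
  rw [convexComb_real p₁.le p₂.le ENNReal.toReal_nonneg he]
  simp only [ENNReal.toReal_zero, zero_mul, add_zero]
  rw [show c₁.toReal = 1 - c₂.toReal by linarith]

/-- `ν` is a nontrivial mixture of decreasing measures on `[l, r]`. -/
def IsSplit (l r : ℝ) (ν : ProbabilityMeasure ℝ) : Prop :=
  ∃ w A B, 0 < w ∧ w < 1 ∧ IsMix w ν A B ∧ A ≠ B ∧ IsDec l r (A : Measure ℝ) ∧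
    IsDec l r (B : Measure ℝ)

/-- `ν` is a nontrivial mixture of decreasing measures on `[l, r]` of the same mean. -/
def IsMeanSplit (l r : ℝ) (ν : ProbabilityMeasure ℝ) : Prop :=
  ∃ A B, IsMix (1 / 2) ν A B ∧ A ≠ B ∧ IsDec l r (A : Measure ℝ) ∧ IsDec l r (B : Measure ℝ) ∧
    ∫ x, x ∂(A : Measure ℝ) = ∫ x, x ∂(B : Measure ℝ)

theorem isSplit_of_add {l r : ℝ} {ν : ProbabilityMeasure ℝ} {P₁ P₂ : Measure ℝ}
    (hν : (ν : Measure ℝ) = P₁ + P₂) (d₁ : IsDec l r P₁) (d₂ : IsDec l r P₂) {T : Set ℝ}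
    (h₁ : P₁ T ≠ 0) (h₂ : P₂ T = 0) (h₂' : P₂ univ ≠ 0) : IsSplit l r ν := by
  have hu : P₁ univ + P₂ univ = 1 := by
    rw [← Measure.add_apply, ← hν, measure_univ]
  have h₁' : P₁ univ ≠ 0 := fun h => h₁ (measure_mono_null (subset_univ _) h)
  obtain ⟨A, dA, eA⟩ := exists_probability_smul_eq d₁ h₁'
    (ne_top_of_le_ne_top ENNReal.one_ne_top (hu ▸ le_self_add))
  obtain ⟨B, dB, eB⟩ := exists_probability_smul_eq d₂ h₂'
    (ne_top_of_le_ne_top ENNReal.one_ne_top (hu ▸ le_add_self))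
  obtain ⟨w, w0, w1, hw⟩ := exists_isMix_of_eq (ν := ν) (A := A) (B := B) h₁' h₂' (by rw [hν, ← eA, ← eB])
  refine ⟨w, A, B, w0, w1, hw, fun hAB => ?_, dA, dB⟩
  rw [eA, Measure.smul_apply, smul_eq_mul] at h₁
  rw [eB, Measure.smul_apply, smul_eq_mul, ← hAB] at h₂
  rcases mul_eq_zero.1 h₂ with h | h
  · exact h₂' h
  · exact h₁ (by rw [h, mul_zero])

theorem isMeanSplit_of_add {l r : ℝ} (hlr : l ≤ r) {ν : ProbabilityMeasure ℝ}
    {P₁ P₂ P₃ : Measure ℝ} (hν : (ν : Measure ℝ) = P₁ + P₂ + P₃) (d₁ : IsDec l r P₁)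
    (d₂ : IsDec l r P₂) (d₃ : IsDec l r P₃) {T₁ T₂ : Set ℝ} (h₁ : P₁ T₁ ≠ 0) (h₁₂ : P₂ T₁ = 0) (h₁₃ : P₃ T₁ = 0) (h₂ : P₂ T₂ ≠ 0)
    (h₂₃ : P₃ T₂ = 0) (h₃ : P₃ univ ≠ 0) : IsMeanSplit l r ν := by
  have hu : P₁ univ + P₂ univ + P₃ univ = 1 := by
    rw [← Measure.add_apply, ← Measure.add_apply, ← hν, measure_univ]
  have h₁' : P₁ univ ≠ 0 := fun h => h₁ (measure_mono_null (subset_univ _) h)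
  have h₂' : P₂ univ ≠ 0 := fun h => h₂ (measure_mono_null (subset_univ _) h)
  have t12 : P₁ univ + P₂ univ ≠ ⊤ :=
    ne_top_of_le_ne_top ENNReal.one_ne_top (hu ▸ le_self_add)
  have t₁ := ne_top_of_le_ne_top t12 le_self_add
  have t₂ := ne_top_of_le_ne_top t12 le_add_self
  have t₃ : P₃ univ ≠ ⊤ := ne_top_of_le_ne_top ENNReal.one_ne_top (hu ▸ le_add_self)
  obtain ⟨ν₁, D₁, e₁⟩ := exists_probability_smul_eq d₁ h₁' t₁
  obtain ⟨ν₂, D₂, e₂⟩ := exists_probability_smul_eq d₂ h₂' t₂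
  obtain ⟨ν₃, D₃, e₃⟩ := exists_probability_smul_eq d₃ h₃ t₃
  obtain ⟨hs, he⟩ := toReal_weights (ν := ν) (c₁ := P₁ univ) (c₂ := P₂ univ) (c₃ := P₃ univ)
    (ν₁ := ν₁) (ν₂ := ν₂) (ν₃ := ν₃) (by rw [hν, ← e₁, ← e₂, ← e₃])
  have zero_of : ∀ {P : Measure ℝ} {M : ProbabilityMeasure ℝ} {T : Set ℝ},
      P = P univ • (M : Measure ℝ) → P univ ≠ 0 → P T = 0 → (M : Measure ℝ).real T = 0 :=
    fun {P M T} h h0 hT => by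
      rw [h, Measure.smul_apply, smul_eq_mul] at hT
      rw [Measure.real, (mul_eq_zero.1 hT).resolve_left h0, ENNReal.toReal_zero]
  have ne_of : ∀ {P : Measure ℝ} {M : ProbabilityMeasure ℝ} {T : Set ℝ},
      P = P univ • (M : Measure ℝ) → P T ≠ 0 → (M : Measure ℝ).real T ≠ 0 :=
    fun {P M T} h hT h0 => by
      rw [h, Measure.smul_apply, smul_eq_mul] at hT
      rw [measureReal_eq_zero_iff] at h0
      exact hT (by rw [h0, mul_zero])
  have p₁ : 0 < (P₁ univ).toReal := ENNReal.toReal_pos h₁' t₁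
  have p₂ : 0 < (P₂ univ).toReal := ENNReal.toReal_pos h₂' t₂
  have p₃ : 0 < (P₃ univ).toReal := ENNReal.toReal_pos h₃ t₃
  have z₁₂ := zero_of e₂ h₂' h₁₂
  have z₁₃ := zero_of e₃ h₃ h₁₃
  have z₂₃ := zero_of e₃ h₃ h₂₃
  have n₁ := ne_of e₁ h₁
  have n₂ := ne_of e₂ h₂
  generalize (P₁ univ).toReal = w₁ at *
  generalize (P₂ univ).toReal = w₂ at *
  generalize (P₃ univ).toReal = w₃ at *
  have shape : ∀ {M : ProbabilityMeasure ℝ}, IsDec l r (M : Measure ℝ) →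
      HasShape 0 1 l r (2 * ∫ x, x ∂(M : Measure ℝ)) M := fun h =>
    ⟨by simpa using h, hlr, by ring⟩
  set E₁ := ∫ x, x ∂(ν₁ : Measure ℝ)
  set E₂ := ∫ x, x ∂(ν₂ : Measure ℝ)
  set E₃ := ∫ x, x ∂(ν₃ : Measure ℝ)
  obtain ⟨c₁, c₂, c₃, hc, hc0, hcE⟩ : ∃ c₁ c₂ c₃ : ℝ, ¬ (c₁ = 0 ∧ c₂ = 0 ∧ c₃ = 0) ∧
      c₁ + c₂ + c₃ = 0 ∧ c₁ * E₁ + c₂ * E₂ + c₃ * E₃ = 0 := by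
    by_cases h : E₂ - E₃ = 0 ∧ E₃ - E₁ = 0 ∧ E₁ - E₂ = 0
    · refine ⟨1, -1, 0, by simp, by ring, by linarith⟩
    · exact ⟨_, _, _, h, by ring, by ring⟩
  have hδ : ∃ δ, 0 < δ ∧ δ * |c₁| < w₁ ∧ δ * |c₂| < w₂ ∧ δ * |c₃| < w₃ := by
    have : ∀ {c w : ℝ}, 0 < w → ∀ᶠ δ in nhdsWithin (0 : ℝ) (Ioi 0), δ * c < w := fun {c w} hw => by
      refine nhdsWithin_le_nhds ?_
      have : Filter.Tendsto (fun δ : ℝ => δ * c) (nhds 0) (nhds (0 * c)) :=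
        (continuous_id.mul continuous_const).tendsto 0
      rw [zero_mul] at this
      exact this.eventually_lt_const hw
    exact ((eventually_mem_nhdsWithin (α := ℝ) (a := 0) (s := Ioi 0)).and
      ((this p₁).and ((this p₂).and (this p₃)))).exists
  obtain ⟨δ, δ0, δ1, δ2, δ3⟩ := hδ
  have bd : ∀ {c w : ℝ}, δ * |c| < w → 0 ≤ w + δ * c ∧ 0 ≤ w - δ * c := fun {c w} h => by
    have := abs_lt.1 (show |δ * c| < w by rwa [abs_mul, abs_of_pos δ0])
    constructor <;> linarith [this.1, this.2]
  have sA : w₁ + δ * c₁ + (w₂ + δ * c₂) + (w₃ + δ * c₃) = 1 := by linear_combination hs + δ * hc0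
  have sB : w₁ - δ * c₁ + (w₂ - δ * c₂) + (w₃ - δ * c₃) = 1 := by linear_combination hs - δ * hc0
  obtain ⟨A, hA⟩ := exists_convexComb (bd δ1).1 (bd δ2).1 (bd δ3).1 sA ν₁ ν₂ ν₃
  obtain ⟨B, hB⟩ := exists_convexComb (bd δ1).2 (bd δ2).2 (bd δ3).2 sB ν₁ ν₂ ν₃
  have shA := HasShape.convexComb one_pos (bd δ1).1 (bd δ2).1 (bd δ3).1 sA hA
    (shape D₁) (shape D₂) (shape D₃)
  have shB := HasShape.convexComb one_pos (bd δ1).2 (bd δ2).2 (bd δ3).2 sB hB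
    (shape D₁) (shape D₂) (shape D₃)
  refine ⟨A, B, fun S _ => ?_, fun hAB => hc ?_, by simpa using shA.isDec,
    by simpa using shB.isDec, ?_⟩
  · rw [convexComb_real p₁.le p₂.le p₃.le he, convexComb_real (bd δ1).1 (bd δ2).1 (bd δ3).1 hA,
      convexComb_real (bd δ1).2 (bd δ2).2 (bd δ3).2 hB]
    ring
  · have eq : ∀ S, c₁ * (ν₁ : Measure ℝ).real S + c₂ * (ν₂ : Measure ℝ).real S +
        c₃ * (ν₃ : Measure ℝ).real S = 0 := fun S => by
      have a := convexComb_real (bd δ1).1 (bd δ2).1 (bd δ3).1 hA S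
      have b := convexComb_real (bd δ1).2 (bd δ2).2 (bd δ3).2 hB S
      rw [hAB, b] at a
      apply mul_left_cancel₀ δ0.ne'
      linear_combination (-1 / 2 : ℝ) * a
    have q₁ := eq T₁
    rw [z₁₂, z₁₃] at q₁
    have k₁ : c₁ = 0 := (mul_eq_zero.1 (by linarith : c₁ * (ν₁ : Measure ℝ).real T₁ = 0)).resolve_right n₁
    have q₂ := eq T₂
    rw [z₂₃, k₁] at q₂
    have k₂ : c₂ = 0 := (mul_eq_zero.1 (by linarith : c₂ * (ν₂ : Measure ℝ).real T₂ = 0)).resolve_right n₂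
    exact ⟨k₁, k₂, by linarith⟩
  · rw [shA.mean, shB.mean]
    linear_combination (2 * δ) * hcE

section

variable {l r : ℝ} {p : ℝ≥0∞} {g : ℝ → ℝ≥0∞} {ν : ProbabilityMeasure ℝ}

theorem antitone_min_const (hg : Antitone g) (h : ℝ≥0∞) : Antitone fun x => min (g x) h :=
  fun _ _ hxy => min_le_min_right h (hg hxy)

theorem antitone_tsub_const (hg : Antitone g) (h : ℝ≥0∞) : Antitone fun x => g x - h :=
  fun _ _ hxy => tsub_le_tsub_right (hg hxy) h

theorem atomDensity_eq_add_level (hg : Antitone g) (h : ℝ≥0∞) : atomDensity l p g =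
    atomDensity l 0 (fun x => min (g x) h) + atomDensity l p (fun x => g x - h) := by
  rw [← atomDensity_add (antitone_min_const hg h).measurable, zero_add]
  congr 1
  ext x
  rw [Pi.add_apply, add_comm]
  exact tsub_add_min.symm

theorem atomDensity_univ_ne_zero (hg : Antitone g) (h : p ≠ 0 ∨ ∃ x, l < x ∧ g x ≠ 0) :
    atomDensity l p g univ ≠ 0 := by
  rcases h with h | ⟨x, hx, h⟩
  · intro h0
    have h1 : (p • Measure.dirac l) univ ≤ atomDensity l p g univ := Measure.le_add_right le_rfl _
    rw [h0] at h1
    simp at h1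
    exact h h1
  · exact fun h0 => atomDensity_Ioi_ne_zero hg le_rfl hx h (measure_mono_null (subset_univ _) h0)

theorem isSplit_of_level (hg : Antitone g) (hc : ∀ x v, v < g x → ∃ y, x < y ∧ v < g y)
    (h0 : ∀ x, r < x → g x = 0) (hν : (ν : Measure ℝ) = atomDensity l p g) {y : ℝ} (hly : l < y)
    (hy : g y ≠ 0) (htop : p ≠ 0 ∨ ∃ x, l < x ∧ g y < g x) : IsSplit l r ν := by
  obtain ⟨z, hyz, hz⟩ := hc y 0 (pos_iff_ne_zero.2 hy)
  refine isSplit_of_add (T := Ioi y) (hν.trans (atomDensity_eq_add_level hg (g y)))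
    (isDec_atomDensity (antitone_min_const hg _) fun x hx => by simp [h0 x hx])
    (isDec_atomDensity (antitone_tsub_const hg _) fun x hx => by simp [h0 x hx])
    (atomDensity_Ioi_ne_zero (antitone_min_const hg _) hly.le hyz ?_)
    (atomDensity_Ioi_eq_zero hly.le fun x hx => tsub_eq_zero_of_le (hg hx.le))
    (atomDensity_univ_ne_zero (antitone_tsub_const hg _) ?_)
  · exact (lt_min hz (pos_iff_ne_zero.2 hy)).ne'
  · exact htop.imp id fun ⟨x, hx, h⟩ => ⟨x, hx, (tsub_pos_of_lt h).ne'⟩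

theorem isMeanSplit_of_levels (hlr : l ≤ r) (hg : Antitone g)
    (hc : ∀ x v, v < g x → ∃ y, x < y ∧ v < g y)
    (h0 : ∀ x, r < x → g x = 0) (hν : (ν : Measure ℝ) = atomDensity l p g) {y z : ℝ} (hly : l < y)
    (hlz : l < z) (hz : g z ≠ 0) (hzy : g z < g y) (htop : p ≠ 0 ∨ ∃ x, l < x ∧ g y < g x) :
    IsMeanSplit l r ν := by
  have ga := antitone_min_const hg (g y)
  obtain ⟨z', hzz', hz'⟩ := hc z 0 (pos_iff_ne_zero.2 hz)
  obtain ⟨y', hyy', hy'⟩ := hc y (g z) hzy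
  have hyz : y < z := not_le.1 fun h => (hg h).not_gt hzy
  have e : atomDensity l p g = atomDensity l 0 (fun x => min (min (g x) (g y)) (g z)) +
      atomDensity l 0 (fun x => min (g x) (g y) - g z) + atomDensity l p (fun x => g x - g y) := by
    rw [← atomDensity_eq_add_level ga, ← atomDensity_eq_add_level hg]
  refine isMeanSplit_of_add hlr (hν.trans e) (T₁ := Ioi z) (T₂ := Ioi y)
    (isDec_atomDensity (antitone_min_const ga _) fun x hx => by simp [h0 x hx])
    (isDec_atomDensity (antitone_tsub_const ga _) fun x hx => by simp [h0 x hx])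
    (isDec_atomDensity (antitone_tsub_const hg _) fun x hx => by simp [h0 x hx])
    (atomDensity_Ioi_ne_zero (antitone_min_const ga _) hlz.le hzz' ?_)
    (atomDensity_Ioi_eq_zero hlz.le fun x hx =>
      tsub_eq_zero_of_le ((min_le_left _ _).trans (hg hx.le)))
    (atomDensity_Ioi_eq_zero hlz.le fun x hx => tsub_eq_zero_of_le (hg (hyz.trans hx).le))
    (atomDensity_Ioi_ne_zero (antitone_tsub_const ga _) hly.le hyy' ?_)
    (atomDensity_Ioi_eq_zero hly.le fun x hx => tsub_eq_zero_of_le (hg hx.le))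
    (atomDensity_univ_ne_zero (antitone_tsub_const hg _) ?_)
  · exact (lt_min (lt_min hz' (bot_le.trans_lt hzy)) (pos_iff_ne_zero.2 hz)).ne'
  · exact (tsub_pos_of_lt (lt_min hy' hzy)).ne'
  · exact htop.imp id fun ⟨x, hx, h⟩ => ⟨x, hx, (tsub_pos_of_lt h).ne'⟩

theorem exists_withDensity_eq_smul_unif {f : ℝ → ℝ≥0∞} (hf : Antitone f)
    (h0 : ∀ x, r < x → f x = 0) {z : ℝ} (hlz : l < z) (hz : f z ≠ 0)
    (hv : ∀ x, l < x → f x ≠ 0 → f x = f z) :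
    ∃ b, l < b ∧ b ≤ r ∧ (∀ x, l < x → f x ≠ 0 → x ≤ b) ∧ (∀ x, l < x → f x = 0 → b ≤ x) ∧
      ∃ c : ℝ≥0∞, c ≠ 0 ∧ (volume.restrict (Ioi l)).withDensity f = c • (unif l b : Measure ℝ) := by
  set S := {x | l < x ∧ f x ≠ 0} with hS
  have hbdd : BddAbove S := ⟨r, fun x hx => not_lt.1 fun h => hx.2 (h0 x h)⟩
  have hzS : z ∈ S := ⟨hlz, hz⟩
  set b := sSup S with hb
  have hlb : l < b := hlz.trans_le (le_csSup hbdd hzS)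
  refine ⟨b, hlb, csSup_le ⟨z, hzS⟩ fun x hx => not_lt.1 fun h => hx.2 (h0 x h),
    fun x hx h => le_csSup hbdd ⟨hx, h⟩, fun x hx h => csSup_le ⟨z, hzS⟩ fun s hs =>
      not_lt.1 fun hlt => hs.2 (le_antisymm ((hf hlt.le).trans h.le) bot_le),
    f z * volume (Ioc l b), mul_ne_zero hz (by simp [hlb]), ?_⟩
  have hae : f =ᵐ[volume.restrict (Ioi l)] (Iic b).indicator fun _ => f z := by
    filter_upwards [ae_restrict_mem measurableSet_Ioi,
      ae_restrict_of_ae (compl_mem_ae_iff.2 (measure_singleton b))] with x hx hxb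
    rcases lt_or_gt_of_ne (show x ≠ b from hxb) with hlt | hlt
    · obtain ⟨s, hs, hxs⟩ := exists_lt_of_lt_csSup ⟨z, hzS⟩ hlt
      rw [indicator_of_mem (mem_Iic.2 hlt.le)]
      exact hv x hx fun h => hs.2 (le_antisymm ((hf hxs.le).trans h.le) bot_le)
    · rw [indicator_of_notMem (by simpa using hlt)]
      by_contra h
      exact hlt.not_ge (le_csSup hbdd ⟨hx, h⟩)
  rw [withDensity_congr_ae hae, withDensity_indicator measurableSet_Iic,
    Measure.restrict_restrict measurableSet_Iic, Iic_inter_Ioi, withDensity_const, unif_of_lt hlb,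
    smul_smul, mul_assoc, ENNReal.mul_inv_cancel (by simp [hlb]) (by simp), mul_one]

theorem smul_unif_eq {c : ℝ≥0∞} {M : ProbabilityMeasure ℝ}
    (h : (ν : Measure ℝ) = c • (M : Measure ℝ)) : ν = M := by
  have : c = 1 := by
    have := congrArg (fun ν : Measure ℝ => ν univ) h
    simpa using this.symm
  rw [this, one_smul] at h
  exact Subtype.ext h

/-- A decreasing measure on `[l, r]` is uniform, or a mixture of two uniform measures, or splits
into decreasing measures of the same mean. -/
theorem eq_unif_or_isSplit (hlr : l ≤ r) (h : IsDec l r (ν : Measure ℝ)) :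
    (∃ t, l ≤ t ∧ t ≤ r ∧ ν = unif l t) ∨ IsSplit l r ν ∧
      ((∃ a b y, l ≤ a ∧ a < b ∧ b ≤ r ∧ 0 < y ∧ y < 1 ∧ IsMix y ν (unif l a) (unif l b)) ∨
        IsMeanSplit l r ν) := by
  obtain ⟨p, g', hg', h0', hν'⟩ := h
  obtain ⟨g, hg, hc, hle, hae⟩ := exists_antitone_rightContinuous hg'
  have h0 : ∀ x, r < x → g x = 0 := fun x hx => le_antisymm ((hle x).trans (h0' x hx).le) bot_le
  have hν : (ν : Measure ℝ) = atomDensity l p g := by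
    rw [hν', atomDensity, withDensity_congr_ae (ae_restrict_of_ae hae)]
  clear hν' hae hle h0' hg'
  by_cases hz : ∃ z, l < z ∧ g z ≠ 0
  swap
  · left
    push Not at hz
    refine ⟨l, le_rfl, hlr, smul_unif_eq (c := p) ?_⟩
    rw [hν, atomDensity, unif_self, (withDensity_eq_zero_iff hg.measurable.aemeasurable).2, add_zero]
    filter_upwards [ae_restrict_mem measurableSet_Ioi] with x hx using hz x hx
  obtain ⟨z, hlz, hz⟩ := hz
  by_cases hall : ∀ x, l < x → g x ≠ 0 → g x = g z
  · obtain ⟨b, hlb, hbr, -, -, c, hc0, hcb⟩ :=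
      exists_withDensity_eq_smul_unif hg h0 hlz hz hall
    by_cases hp : p = 0
    · left
      refine ⟨b, hlb.le, hbr, smul_unif_eq (c := c) ?_⟩
      rw [hν, atomDensity, hp, hcb]
      simp
    · right
      refine ⟨isSplit_of_level hg hc h0 hν hlz hz (Or.inl hp), Or.inl ?_⟩
      obtain ⟨y, hy0, hy1, hy⟩ := exists_isMix_of_eq (ν := ν) (A := unif l l) (B := unif l b) hp hc0
        (by rw [hν, atomDensity, hcb, unif_self])
      exact ⟨l, b, y, le_rfl, hlb, hbr, hy0, hy1, hy⟩
  right
  obtain ⟨y, z, hly, hlz, hz, hzy⟩ : ∃ y z, l < y ∧ l < z ∧ g z ≠ 0 ∧ g z < g y := by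
    push Not at hall
    obtain ⟨x, hx, hx0, hne⟩ := hall
    rcases lt_or_gt_of_ne hne with hlt | hlt
    · exact ⟨z, x, hlz, hx, hx0, hlt⟩
    · exact ⟨x, z, hx, hlz, hz, hlt⟩
  refine ⟨isSplit_of_level hg hc h0 hν hlz hz (Or.inr ⟨y, hly, hzy⟩), ?_⟩
  by_cases hp : p = 0
  swap
  · exact Or.inr (isMeanSplit_of_levels hlr hg hc h0 hν hly hlz hz hzy (Or.inl hp))
  by_cases hthree : ∃ x, l < x ∧ g x ≠ 0 ∧ g x ≠ g y ∧ g x ≠ g z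
  · right
    obtain ⟨x, hx, hx0, hxy, hxz⟩ := hthree
    rcases lt_or_gt_of_ne hxz with h1 | h1
    · exact isMeanSplit_of_levels hlr hg hc h0 hν hlz hx hx0 h1 (Or.inr ⟨y, hly, hzy⟩)
    · rcases lt_or_gt_of_ne hxy with h2 | h2
      · exact isMeanSplit_of_levels hlr hg hc h0 hν hx hlz hz h1 (Or.inr ⟨y, hly, h2⟩)
      · exact isMeanSplit_of_levels hlr hg hc h0 hν hly hlz hz hzy (Or.inr ⟨x, hx, h2⟩)
  · left
    have hval : ∀ x, l < x → g x ≠ 0 → g x = g y ∨ g x = g z := fun x hx hx0 => by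
      by_contra hcon
      push Not at hcon
      exact hthree ⟨x, hx, hx0, hcon.1, hcon.2⟩
    obtain ⟨b, hlb, hbr, hb1, -, c, hc0, hcb⟩ :=
      exists_withDensity_eq_smul_unif (l := l) (r := r) (z := z) (antitone_min_const hg (g z))
        (fun x hx => by simp [h0 x hx]) hlz (by simpa using hz)
        (fun x hx hx0 => by
          have : g x ≠ 0 := fun h => hx0 (by simp [h])
          rcases hval x hx this with h | h
          · simp [h, hzy.le]
          · simp [h])
    obtain ⟨a, hla, har, ha1, ha2, c', hc0', hca⟩ :=
      exists_withDensity_eq_smul_unif (l := l) (r := r) (z := y) (antitone_tsub_const hg (g z))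
        (fun x hx => by simp [h0 x hx]) hly (tsub_pos_of_lt hzy).ne'
        (fun x hx hx0 => by
          have : g x ≠ 0 := fun h => hx0 (by simp [h])
          rcases hval x hx this with h | h
          · simp [h]
          · simp [h] at hx0)
    have haz : a ≤ z := ha2 z hlz (by simp)
    obtain ⟨z', hzz', hz'⟩ := hc z 0 (pos_iff_ne_zero.2 hz)
    have hz'b : z' ≤ b := hb1 z' (hlz.trans hzz') (lt_min hz' (pos_iff_ne_zero.2 hz)).ne'
    obtain ⟨w, hw0, hw1, hw⟩ := exists_isMix_of_eq (ν := ν) (A := unif l a) (B := unif l b) hc0' hc0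
      (by rw [hν, atomDensity_eq_add_level hg (g z), atomDensity, atomDensity, hcb, hca, hp]
          simp [add_comm])
    exact ⟨a, b, w, hla.le, haz.trans_lt (hzz'.trans_le hz'b), hbr, hw0, hw1, hw⟩

end

theorem IsMix.refl (ε : ℝ) (ν : ProbabilityMeasure ℝ) : IsMix ε ν ν ν := fun S _ => by ring

theorem IsMix.left_eq {ε : ℝ} {ν A B : ProbabilityMeasure ℝ} (h : IsMix ε ν A B) (h1 : ε < 1)
    (hB : ν = B) : A = B := probabilityMeasure_ext_real fun S hS => by
  have := h S hS
  rw [hB] at this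
  apply mul_left_cancel₀ (sub_pos.2 h1).ne'
  linear_combination -this

theorem hasShape_of_isDec {o d u v : ℝ} (hd : 0 < d) (huv : u ≤ v) {ν : ProbabilityMeasure ℝ}
    (h : IsDec (o + d * u) (o + d * v) (ν : Measure ℝ)) :
    HasShape o d u v (2 * (∫ x, x ∂(ν : Measure ℝ) - o) / d) ν :=
  ⟨h, huv, by field_simp; ring⟩

theorem IsMix.perturb {o d u v w e eA eB : ℝ} (hd : 0 < d) {ν A B : ProbabilityMeasure ℝ}
    (h : IsMix w ν A B) (h0 : 0 < w) (h1 : w < 1) (hAB : A ≠ B) (hν : HasShape o d u v e ν)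
    (hA : HasShape o d u v eA A) (hB : HasShape o d u v eB B) {c : ℝ} (hc : |c| < min w (1 - w)) :
    ∃ P Q eP, IsMix (1 / 2) ν P Q ∧ HasShape o d u v eP P ∧
      HasShape o d u v (e + c * (eA - eB)) Q ∧ (ν = Q → c = 0) := by
  have he := hν.mean_of_isMix hd h0.le h1.le h hA hB
  obtain ⟨c1, c2⟩ := abs_lt.1 (hc.trans_le (min_le_left _ _))
  obtain ⟨c3, c4⟩ := abs_lt.1 (hc.trans_le (min_le_right _ _))
  have p₁ : 0 ≤ 1 - w - c := by linarith
  have p₂ : 0 ≤ w + c := by linarith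
  have q₁ : 0 ≤ 1 - w + c := by linarith
  have q₂ : 0 ≤ w - c := by linarith
  obtain ⟨P, hP⟩ := exists_convexComb p₁ p₂ le_rfl (by ring) A B B
  obtain ⟨Q, hQ⟩ := exists_convexComb q₁ q₂ le_rfl (by ring) A B B
  refine ⟨P, Q, _, fun S hS => ?_, HasShape.convexComb hd p₁ p₂ le_rfl (by ring) hP hA hB hB, ?_,
    fun hνQ => ?_⟩
  · rw [convexComb_real p₁ p₂ le_rfl hP, convexComb_real q₁ q₂ le_rfl hQ, h S hS]
    ring
  · have := HasShape.convexComb hd q₁ q₂ le_rfl (by ring) hQ hA hB hB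
    convert this using 1
    rw [he]
    ring
  · by_contra hc0
    refine hAB (probabilityMeasure_ext_real fun S hS => ?_)
    have a := h S hS
    rw [hνQ, convexComb_real q₁ q₂ le_rfl hQ] at a
    apply mul_left_cancel₀ hc0
    linear_combination a

theorem eq_unifAt_or_isSplit {o d e : ℝ} (hd : 0 < d) {ν : ProbabilityMeasure ℝ}
    (h : HasShape o d 0 1 e ν) :
    (∃ t, 0 ≤ t ∧ t ≤ 1 ∧ ν = unifAt o d 0 t) ∨ IsSplit (o + d * 0) (o + d * 1) ν ∧
      ((∃ a b y, 0 ≤ a ∧ a < b ∧ b ≤ 1 ∧ 0 < y ∧ y < 1 ∧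
          IsMix y ν (unifAt o d 0 a) (unifAt o d 0 b)) ∨
        IsMeanSplit (o + d * 0) (o + d * 1) ν) := by
  have e' : ∀ t : ℝ, o + d * ((t - o) / d) = t := fun t => by
    field_simp
    ring
  have hunif : ∀ t, unif (o + d * 0) t = unifAt o d 0 ((t - o) / d) := fun t => by
    rw [unifAt, e']
  have h0 : ∀ {t}, o + d * 0 ≤ t → 0 ≤ (t - o) / d := fun ht => div_nonneg (by linarith) hd.le
  have h1 : ∀ {t}, t ≤ o + d * 1 → (t - o) / d ≤ 1 := fun ht => by
    rw [div_le_one hd]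
    linarith
  rcases eq_unif_or_isSplit (by nlinarith) h.isDec with ⟨t, h2, h3, h4⟩ |
    ⟨hs, ⟨a, b, y, h2, h3, h4, h5, h6, h7⟩ | hm⟩
  · exact Or.inl ⟨_, h0 h2, h1 h3, h4.trans (hunif t)⟩
  · refine Or.inr ⟨hs, Or.inl ⟨_, _, y, h0 h2, ?_, h1 h4, h5, h6, ?_⟩⟩
    · exact div_lt_div_of_pos_right (by linarith) hd
    · rwa [← hunif, ← hunif]
  · exact Or.inr ⟨hs, Or.inr hm⟩

section

variable {N : ℕ} {o e : Fin N → ℝ} {d : ℝ} {ν : Fin N → ProbabilityMeasure ℝ}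

theorem not_isRigid_of_isMeanSplit (hd : 0 < d) (hν : ∀ k, HasShape (o k) d 0 1 (e k) (ν k))
    (he : ∑ k, e k = 2) {j : Fin N} (hj : IsMeanSplit (o j + d * 0) (o j + d * 1) (ν j)) :
    ¬ IsRigid o d ν := by
  intro H
  obtain ⟨A, B, hmix, hAB, dA, dB, hm⟩ := hj
  have sA := hasShape_of_isDec hd zero_le_one dA
  have sB := hasShape_of_isDec hd zero_le_one dB
  have hej := (hν j).mean_of_isMix hd (by norm_num) (by norm_num) hmix sA sB
  rw [hm, ← add_mul, sub_add_cancel, one_mul] at hej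
  rw [← hej] at sB
  have hB := H (1 / 2) (Function.update ν j A) (Function.update ν j B) 0 1 0 1 e (by norm_num)
    (by norm_num) ?_ ?_ ?_ (by simp) (by simp) he
  · have := congrFun hB j
    rw [Function.update_self] at this
    exact hAB (hmix.left_eq (by norm_num) this)
  · intro k
    by_cases hk : k = j
    · subst hk
      simpa using hmix
    · simpa [hk] using IsMix.refl _ (ν k)
  · intro k
    by_cases hk : k = j
    · subst hk
      exact ⟨_, by simpa using sA⟩
    · exact ⟨_, by simpa [hk] using hν k⟩
  · intro k
    by_cases hk : k = j
    · subst hk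
      simpa using sB
    · simpa [hk] using hν k

theorem not_isRigid_of_isSplit (hd : 0 < d) (hν : ∀ k, HasShape (o k) d 0 1 (e k) (ν k))
    (he : ∑ k, e k = 2) {i j : Fin N} (hij : i ≠ j)
    (hi : IsSplit (o i + d * 0) (o i + d * 1) (ν i))
    (hj : IsSplit (o j + d * 0) (o j + d * 1) (ν j)) : ¬ IsRigid o d ν := by
  intro H
  obtain ⟨w, A, B, w0, w1, hmix, hAB, dA, dB⟩ := hi
  obtain ⟨w', A', B', w0', w1', hmix', hAB', dA', dB'⟩ := hj
  have sA := hasShape_of_isDec hd zero_le_one dA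
  have sB := hasShape_of_isDec hd zero_le_one dB
  have sA' := hasShape_of_isDec hd zero_le_one dA'
  have sB' := hasShape_of_isDec hd zero_le_one dB'
  generalize 2 * (∫ x, x ∂(A : Measure ℝ) - o i) / d = eA at sA
  generalize 2 * (∫ x, x ∂(B : Measure ℝ) - o i) / d = eB at sB
  generalize 2 * (∫ x, x ∂(A' : Measure ℝ) - o j) / d = eA' at sA'
  generalize 2 * (∫ x, x ∂(B' : Measure ℝ) - o j) / d = eB' at sB'
  obtain ⟨c, c', hc, hcD⟩ : ∃ c c' : ℝ, ¬ (c = 0 ∧ c' = 0) ∧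
      c * (eA - eB) + c' * (eA' - eB') = 0 := by
    by_cases h : eA' - eB' = 0 ∧ -(eA - eB) = 0
    · exact ⟨1, 0, by simp, by linarith [h.2]⟩
    · exact ⟨_, _, h, by ring⟩
  have hδ : ∃ δ : ℝ, 0 < δ ∧ δ * |c| < min w (1 - w) ∧ δ * |c'| < min w' (1 - w') := by
    have : ∀ {c w : ℝ}, 0 < w → ∀ᶠ δ in nhdsWithin (0 : ℝ) (Ioi 0), δ * c < w := fun {c w} hw => by
      refine nhdsWithin_le_nhds ?_
      have : Filter.Tendsto (fun δ : ℝ => δ * c) (nhds 0) (nhds (0 * c)) :=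
        (continuous_id.mul continuous_const).tendsto 0
      rw [zero_mul] at this
      exact this.eventually_lt_const hw
    exact ((eventually_mem_nhdsWithin (α := ℝ) (a := 0) (s := Ioi 0)).and
      ((this (lt_min w0 (sub_pos.2 w1))).and (this (lt_min w0' (sub_pos.2 w1'))))).exists
  obtain ⟨δ, δ0, δ1, δ2⟩ := hδ
  rw [show δ * |c| = |δ * c| by rw [abs_mul, abs_of_pos δ0]] at δ1
  rw [show δ * |c'| = |δ * c'| by rw [abs_mul, abs_of_pos δ0]] at δ2
  obtain ⟨P, Q, eP, hPQ, sP, sQ, hQ⟩ := hmix.perturb hd w0 w1 hAB (hν i) sA sB δ1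
  obtain ⟨P', Q', eP', hPQ', sP', sQ', hQ'⟩ := hmix'.perturb hd w0' w1' hAB' (hν j) sA' sB' δ2
  have hB := H (1 / 2) (fun k => if k = i then P else if k = j then P' else ν k)
    (fun k => if k = i then Q else if k = j then Q' else ν k) 0 1 0 1
    (fun k => e k + ((if k = i then δ * c * (eA - eB) else 0) +
      if k = j then δ * c' * (eA' - eB') else 0)) (by norm_num)
    (by norm_num) ?_ ?_ ?_ (by simp) (by simp) ?_
  · have h1 := congrFun hB i
    have h2 := congrFun hB j
    simp only [if_true, hij.symm, if_false] at h1 h2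
    exact hc ⟨(mul_eq_zero.1 (hQ h1)).resolve_left δ0.ne', (mul_eq_zero.1 (hQ' h2)).resolve_left δ0.ne'⟩
  · intro k
    split_ifs with h h'
    · subst h
      exact hPQ
    · subst h'
      exact hPQ'
    · exact IsMix.refl _ _
  · intro k
    split_ifs with h h'
    · subst h
      exact ⟨_, sP⟩
    · subst h'
      exact ⟨_, sP'⟩
    · exact ⟨_, hν k⟩
  · intro k
    split_ifs with h h' h'
    · exact absurd (h.symm.trans h') hij
    · subst h
      simpa using sQ
    · subst h'
      simpa using sQ'
    · simpa using hν k
  · rw [Finset.sum_add_distrib, Finset.sum_add_distrib, he]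
    simp only [Finset.sum_ite_eq', Finset.mem_univ, if_true]
    linear_combination δ * hcD

theorem not_isRigid (hd : 0 < d) (hν : ∀ k, HasShape (o k) d 0 1 (e k) (ν k))
    (he : ∑ k, e k = 2) : ¬ IsRigid o d ν := by
  have heq : ∀ {k t}, 0 ≤ t → ν k = unifAt (o k) d 0 t → e k = t := fun {k t} ht h => by
    have s := hν k
    rw [h] at s
    simpa using s.unique hd (hasShape_unifAt hd ht)
  by_cases hall : ∀ k, ∃ t, 0 ≤ t ∧ t ≤ 1 ∧ ν k = unifAt (o k) d 0 t
  · choose t ht0 ht1 ht using hall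
    have hsum : ∑ k, t k = 2 := by
      rw [← he]
      exact Finset.sum_congr rfl fun k _ => (heq (ht0 k) (ht k)).symm
    by_cases hone : ∃ i, t i = 1
    · obtain ⟨i, hi⟩ := hone
      exact not_isRigid_of_unif_one hd ht0 ht hsum hi
    push Not at hone
    obtain ⟨j, -, hj⟩ : ∃ j ∈ Finset.univ, 0 < t j := by
      by_contra hcon
      push Not at hcon
      have := Finset.sum_nonpos hcon
      linarith
    have hlt : ∀ k, t k < 1 := fun k => lt_of_le_of_ne (ht1 k) (hone k)
    refine not_isRigid_of_lt_one (j := j) hd (fun k _ => ht0 k) (fun k _ => hlt k) (fun k _ => ht k)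
      (ht0 j) le_rfl (ht1 j) le_rfl zero_le_one (Or.inl hj) ?_ (by ring) hj (hlt j) ?_
    · rw [ht j]
      exact IsMix.refl _ _
    · rw [Finset.add_sum_erase _ _ (Finset.mem_univ j), hsum]
  · push Not at hall
    obtain ⟨j, hj⟩ := hall
    obtain ⟨hsj, hcase⟩ := (eq_unifAt_or_isSplit hd (hν j)).resolve_left fun ⟨t, h0, h1, h⟩ =>
      hj t h0 h1 h
    intro H
    have hother : ∀ k, ∃ t, k ≠ j → 0 ≤ t ∧ t ≤ 1 ∧ ν k = unifAt (o k) d 0 t := fun k => by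
      by_cases hk : k = j
      · exact ⟨0, fun h => absurd hk h⟩
      · rcases eq_unifAt_or_isSplit hd (hν k) with ⟨t, h⟩ | ⟨hs, -⟩
        · exact ⟨t, fun _ => h⟩
        · exact absurd H (not_isRigid_of_isSplit hd hν he hk hs hsj)
    choose t ht using hother
    rcases hcase with ⟨a, b, y, ha, hab, hb, hy, hy1, hmix⟩ | hm
    swap
    · exact not_isRigid_of_isMeanSplit hd hν he hm H
    have hej := (hν j).unique hd (hmix.hasShape hd hy.le hy1.le
      ((hasShape_unifAt hd ha).mono_right hd hab.le) (hasShape_unifAt hd (ha.trans hab.le)))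
    have hsum : e j + ∑ k ∈ Finset.univ.erase j, t k = 2 := by
      rw [← he, ← Finset.add_sum_erase _ _ (Finset.mem_univ j)]
      congr 1
      refine Finset.sum_congr rfl fun k hk => ?_
      have h := ht k (Finset.ne_of_mem_erase hk)
      exact (heq h.1 h.2.2).symm
    by_cases hone : ∃ i, i ≠ j ∧ t i = 1
    · obtain ⟨i, hij, hi⟩ := hone
      refine not_isRigid_of_one hd hij (fun k _ hk => (ht k hk).1) (fun k _ hk => (ht k hk).2.2)
        ?_ ha hab hb hy hy1 hmix (m := e j) (by linarith) ?_ H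
      · rw [(ht i hij).2.2, hi]
      · rw [Finset.erase_right_comm]
        have := Finset.add_sum_erase (Finset.univ.erase j) t
          (Finset.mem_erase.2 ⟨hij, Finset.mem_univ i⟩)
        linarith
    · push Not at hone
      exact not_isRigid_of_lt_one hd (fun k hk => (ht k hk).1)
        (fun k hk => lt_of_le_of_ne (ht k hk).2.1 (hone k hk)) (fun k hk => (ht k hk).2.2) ha hab.le
        hb hy.le hy1.le (Or.inr hy1) hmix (m := e j) (by linarith) (by nlinarith) (by nlinarith)
        hsum H

end

theorem toSignedTuple_injective {N : ℕ} : Function.Injective (toSignedTuple (N := N)) := by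
  intro μ ν h
  ext1 k
  have hk : (μ k : Measure ℝ) = (ν k : Measure ℝ) :=
    Measure.toSignedMeasure_eq_toSignedMeasure_iff.1 (congrFun h k)
  exact Subtype.ext hk

theorem mem_VSet_of_hasShape {N : ℕ} {C d : ℝ} {o u v e : Fin N → ℝ} (hd : 0 < d)
    (hC : ∑ k, o k + d = C) {A : Fin N → ProbabilityMeasure ℝ}
    (h : ∀ k, HasShape (o k) d (u k) (v k) (e k) (A k))
    (huv : ∀ k, v k - u k ≤ 1 - ∑ i, u i) (he : ∑ k, e k = 2) : A ∈ VSet N C := by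
  refine ⟨?_, fun k => o k + d * u k, fun k => o k + d * v k, fun k => ?_, fun k => ?_⟩
  · simp only [(h _).mean]
    rw [Finset.sum_add_distrib, ← Finset.sum_div, ← Finset.mul_sum, he, ← hC]
    ring
  · have := (h k).le
    rw [Finset.sum_add_distrib, ← Finset.mul_sum, ← hC]
    have := huv k
    constructor <;> nlinarith
  · exact mem_decreasing_of_isDec (by nlinarith [(h k).le]) (h k).isDec

theorem isRigid_of_mem_subextremePoints {N : ℕ} {C d : ℝ} {o e : Fin N → ℝ} (hd : 0 < d)
    (hC : ∑ k, o k + d = C) {μ : Fin N → ProbabilityMeasure ℝ}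
    (hμ : ∀ k, HasShape (o k) d 0 1 (e k) (μ k)) (he : ∑ k, e k = 2)
    (h : toSignedTuple μ ∈ subextremePoints (toSignedTuple '' VSet N C)) : IsRigid o d μ := by
  intro ε A B uA vA uB vB eB ε0 ε1 hmix hA hB hcA hcB heB
  choose eA hA using hA
  have heA : ∑ k, eA k = 2 := by
    have h1 : ∑ k, e k = (1 - ε) * ∑ k, eA k + ε * ∑ k, eB k := by
      rw [Finset.mul_sum, Finset.mul_sum, ← Finset.sum_add_distrib]
      exact Finset.sum_congr rfl fun k _ =>
        (hμ k).mean_of_isMix hd ε0.le ε1.le (hmix k) (hA k) (hB k)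
    apply mul_left_cancel₀ (sub_pos.2 ε1).ne'
    linear_combination he - h1 - ε * heB
  by_contra hne
  refine h.2 ⟨_, ⟨A, mem_VSet_of_hasShape hd hC hA hcA heA, rfl⟩, _,
    ⟨B, mem_VSet_of_hasShape hd hC hB hcB heB, rfl⟩, 1 - ε, fun hAB => hne ?_, by linarith,
    by linarith, ?_⟩
  · have hAB := toSignedTuple_injective hAB
    exact funext fun k => (hmix k).eq_of_eq (congrFun hAB k)
  · funext k
    ext S hS
    have := hmix k S hS
    rw [sub_sub_cancel]
    simpa [toSignedTuple, Measure.toSignedMeasure_apply_measurable hS] using this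

theorem eq_dirac_of_mem_subextremePoints {N : ℕ} {C : ℝ} {μ : Fin N → ProbabilityMeasure ℝ}
    (h : toSignedTuple μ ∈ subextremePoints (toSignedTuple '' VSet N C)) :
    ∃ l : Fin N → ℝ, (∀ k, (μ k : Measure ℝ) = Measure.dirac (l k)) ∧ ∑ k, l k = C := by
  obtain ⟨μ', hμ', heq⟩ := h.1
  obtain rfl := toSignedTuple_injective heq
  obtain ⟨hmean, l, r, hc, hdec⟩ := hμ'
  rcases lt_or_ge 0 (C - ∑ k, l k) with hd | hd
  · exfalso
    set d := C - ∑ k, l k with hdef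
    have hC : ∑ k, l k + d = C := by
      rw [hdef]
      ring
    have hs : ∀ k, HasShape (l k) d 0 1 (2 * (∫ x, x ∂(μ' k : Measure ℝ) - l k) / d) (μ' k) :=
      fun k => hasShape_of_isDec hd zero_le_one <| by
        rw [mul_zero, add_zero, mul_one]
        exact (isDec_of_mem_decreasing (hdec k)).2.mono_right (by linarith [(hc k).2])
    have he : ∑ k, 2 * (∫ x, x ∂(μ' k : Measure ℝ) - l k) / d = 2 := by
      rw [← Finset.sum_div, ← Finset.mul_sum, Finset.sum_sub_distrib, hmean]
      exact mul_div_cancel_right₀ 2 hd.ne'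
    exact not_isRigid hd hs he (isRigid_of_mem_subextremePoints hd hC hs he h)
  · have hdir : ∀ k, (μ' k : Measure ℝ) = Measure.dirac (l k) := fun k => by
      rcases hdec k with ⟨-, h⟩ | ⟨hlt, -⟩
      · exact h
      · linarith [(hc k).2]
    refine ⟨l, hdir, ?_⟩
    rw [← hmean]
    exact Finset.sum_congr rfl fun k _ => by rw [hdir k, integral_dirac]

theorem IsMix.eq_dirac {ε l : ℝ} (h0 : 0 < ε) (h1 : ε < 1) {ν A B : ProbabilityMeasure ℝ}
    (h : IsMix ε ν A B) (hν : (ν : Measure ℝ) = Measure.dirac l) : A = ν ∧ B = ν := by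
  have hc : (ν : Measure ℝ).real {l}ᶜ = 0 := by
    rw [hν, measureReal_eq_zero_iff, Measure.dirac_apply' _ (measurableSet_singleton l).compl]
    simp
  have hm := h _ (measurableSet_singleton l).compl
  rw [hc] at hm
  have key : ∀ M : ProbabilityMeasure ℝ, (M : Measure ℝ).real {l}ᶜ = 0 → M = ν := fun M hM => by
    rw [measureReal_eq_zero_iff] at hM
    have hM' : (M : Measure ℝ) {l} = 1 := (prob_compl_eq_zero_iff (measurableSet_singleton l)).1 hM
    refine Subtype.ext ?_
    change (M : Measure ℝ) = (ν : Measure ℝ)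
    rw [hν, ← Measure.restrict_eq_self_of_ae_mem (s := {l}) (μ := (M : Measure ℝ))
      (mem_ae_iff.2 hM), Measure.restrict_singleton, hM', one_smul]
  have n1 := measureReal_nonneg (μ := (A : Measure ℝ)) (s := {l}ᶜ)
  have n2 := measureReal_nonneg (μ := (B : Measure ℝ)) (s := {l}ᶜ)
  have m1 := mul_nonneg (sub_pos.2 h1).le n1
  have m2 := mul_nonneg h0.le n2
  exact ⟨key A ((mul_eq_zero.1 (by linarith : (1 - ε) * _ = 0)).resolve_left (sub_pos.2 h1).ne'),
    key B ((mul_eq_zero.1 (by linarith : ε * _ = 0)).resolve_left h0.ne')⟩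

theorem mem_subextremePoints_of_eq_dirac {N : ℕ} {C : ℝ} {μ : Fin N → ProbabilityMeasure ℝ}
    {l : Fin N → ℝ} (hμ : ∀ k, (μ k : Measure ℝ) = Measure.dirac (l k)) (hl : ∑ k, l k = C) :
    toSignedTuple μ ∈ subextremePoints (toSignedTuple '' VSet N C) := by
  refine ⟨⟨μ, ⟨?_, l, l, fun k => ?_, fun k => Or.inl ⟨rfl, hμ k⟩⟩, rfl⟩, ?_⟩
  · rw [← hl]
    exact Finset.sum_congr rfl fun k _ => by rw [hμ k, integral_dirac]
  · rw [hl]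
    simp
  · rintro ⟨_, ⟨A, -, rfl⟩, _, ⟨B, -, rfl⟩, α, hne, h0, h1, h⟩
    refine hne (congrArg _ (funext fun k => ?_))
    have hmix : IsMix (1 - α) (μ k) (A k) (B k) := fun S hS => by
      have := congrArg (fun s : SignedMeasure ℝ => s S) (congrFun h k)
      rw [sub_sub_cancel]
      simpa [toSignedTuple, Measure.toSignedMeasure_apply_measurable hS] using this
    obtain ⟨hA, hB⟩ := hmix.eq_dirac (by linarith) (by linarith) (hμ k)
    rw [hA, hB]

theorem mainTheorem2 (N : ℕ) (C : ℝ) (μ : Fin N → ProbabilityMeasure ℝ) :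
    toSignedTuple μ ∈ subextremePoints (toSignedTuple '' VSet N C) ↔
      ∃ l : Fin N → ℝ, (∀ k, (μ k : Measure ℝ) = Measure.dirac (l k)) ∧ ∑ k, l k = C :=
  ⟨eq_dirac_of_mem_subextremePoints, fun ⟨_, hμ, hl⟩ => mem_subextremePoints_of_eq_dirac hμ hl⟩
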